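/- Let $\mathbb F_q$ be a finite field with $q$ elements and let $m\ge 2$ be an integer with $(q,m)=1$. Call $f\in\mathbb F_q[x]$ $m$-th-power-free if no nonconstant polynomial $g$ satisfies $g^m\mid f$ (in particular $f\neq 0$). For such $f$ let $C_f$ be the affine curve $y^m=f(x)$ over $\mathbb F_q$, and let $\tilde C_f$ be its (smooth, affine) normalization, i.e. the spectrum of the integral closure of $\mathbb F_q[x,y]/(y^m-f(x))$ in its total ring of fractions. Let $X_1,\dots,X_q$ be independent, identically distributed random variables with values in $\mathbb Z_{\ge 0}$ such that $$\operatorname{Prob}(X_j=0)=\sum_{0\le s\le m-1}\Bigl(1-\frac1{(m,s,q-1)}\Bigr)\frac{q^{-s}(1-q^{-1})}{1-q^{-m}},\qquad \operatorname{Prob}(X_j=N)=\sum_{\substack{0\le s\le m-1\\ (m,s,q-1)=N}}\frac{q^{-s}(1-q^{-1})}{N(1-q^{-m})}\quad(N\ge 1).$$ Then for every integer $k\ge 0$, $$\lim_{d\to\infty}\frac{\#\{f\in\mathbb F_q[x] : \deg f=d,\ f\ m\text{-th-power-free},\ \#\tilde C_f(\mathbb F_q)=k\}}{\#\{f\in\mathbb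 F_q[x] : \deg f=d,\ f\ m\text{-th-power-free}\}}=\operatorname{Prob}\Bigl(\sum_{i=1}^q X_i=k\Bigr).$$ The same limit holds if in both the numerator and the denominator one restricts to those $f$ for which $\tilde C_f$ is irreducible, and also if one restricts to those $f$ for which $\tilde C_f$ is geometrically irreducible. Moreover, if $q\equiv 1\pmod m$, the $m$-fold cyclic covers of the affine line are exactly the irreducible $\tilde C_f$. Here an $m$-fold cyclic cover is an integral normal affine curve, finite and dominant over $\mathbb A^1_{\mathbb F_q}$, whose automorphism group over $\mathbb A^1$ is cyclic of order $m$ with quotient $\mathbb A^1$. That is, for $f$ $m$-th-power-free with $\tilde C_f$ irreducible, $\tilde C_f\to\mathbb A^1$ is an $m$-fold cyclic cover, and every $m$-fold cyclic cover is isomorphic over $\mathbb A^1$ to $\tilde C_f$ for some $m$-th-power-free $f$ with $\tilde C_f$ irreducible. -/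

import Mathlib

open Polynomial Filter Topology MeasureTheory ProbabilityTheory
open scoped TensorProduct

noncomputable section

namespace Superelliptic

/-- `f` is `m`-th power-free: it is not divisible by the `m`-th power of a nonconstant polynomial. -/
def PowerFree {F : Type*} [Field F] (m : ℕ) (f : F[X]) : Prop :=
  ∀ g : F[X], g ^ m ∣ f → IsUnit g

/-- The coordinate ring `F[x, y] / (y ^ m - f(x))` of the affine curve `C_f`. -/
abbrev CoordRing {F : Type*} [Field F] (m : ℕ) (f : F[X]) : Type _ :=
  AdjoinRoot (X ^ m - C f : F[X][X])

/-- The coordinate ring of the normalization of `C_f`: the integral closure of the coordinate ring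
of `C_f` in its total ring of fractions (the localization at all its nonzerodivisors, defined also
when `C_f` is reducible). The normalization is the spectrum of this ring. -/
abbrev NormRing {F : Type*} [Field F] (m : ℕ) (f : F[X]) : Type _ :=
  integralClosure (CoordRing m f) (FractionRing (CoordRing m f))

/-- The number of `F`-rational points of the normalization of `C_f`. -/
def numPoints {F : Type*} [Field F] (m : ℕ) (f : F[X]) : ℕ :=
  Nat.card (NormRing m f →ₐ[F] F)

/-- The normalization of `C_f` is irreducible. -/
def NormIrreducible {F : Type*} [Field F] (m : ℕ) (f : F[X]) : Prop :=
  IrreducibleSpace (PrimeSpectrum (NormRing m f))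

/-- The normalization of `C_f` is geometrically irreducible: it is irreducible after base change
to an algebraic closure. -/
def NormGeomIrreducible {F : Type*} [Field F] (m : ℕ) (f : F[X]) : Prop :=
  IrreducibleSpace (PrimeSpectrum (AlgebraicClosure F ⊗[F] NormRing m f))

/-- Among the `m`-th power-free polynomials `f` of degree `d` satisfying `Q`, the proportion of
those for which the normalization of `C_f` has exactly `k` rational points. -/
def proportion {F : Type*} [Field F] (m : ℕ) (Q : F[X] → Prop) (k d : ℕ) : ℝ :=
  (Set.ncard {f : F[X] | f.degree = d ∧ PowerFree m f ∧ Q f ∧ numPoints m f = k} : ℝ) /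
    (Set.ncard {f : F[X] | f.degree = d ∧ PowerFree m f ∧ Q f} : ℝ)

/-- `Spec B` is an `m`-fold cyclic cover of the affine line over `F`: it is integral and normal
(hence, over a perfect field, a smooth curve), finite and dominant over the line, and its
automorphisms over the line form a cyclic group of order `m` with quotient the line. -/
structure IsCyclicCover (F : Type*) [Field F] (m : ℕ) (B : Type*) [CommRing B]
    [Algebra F[X] B] : Prop where
  isDomain : IsDomain B
  isIntegrallyClosed : IsIntegrallyClosed B
  finite : Module.Finite F[X] B
  injective : Function.Injective (algebraMap F[X] B)
  isCyclic : IsCyclic (B ≃ₐ[F[X]] B)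
  card_aut : Nat.card (B ≃ₐ[F[X]] B) = m
  invariant : ∀ b : B, (∀ σ : B ≃ₐ[F[X]] B, σ b = b) → ∃ a : F[X], algebraMap F[X] B a = b

/-- The greatest common divisor `(m, s, q - 1)`. -/
def tgcd (q m s : ℕ) : ℕ := Nat.gcd (Nat.gcd m s) (q - 1)

/-- The probability that one of the limiting random variables takes the value `N`. -/
def pointProb (q m N : ℕ) : ℝ :=
  if N = 0 then
    ∑ s ∈ Finset.range m,
      (1 - 1 / (tgcd q m s : ℝ)) *
        (((q : ℝ)⁻¹ ^ s * (1 - (q : ℝ)⁻¹)) / (1 - (q : ℝ)⁻¹ ^ m))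
  else
    ∑ s ∈ Finset.range m with tgcd q m s = N,
      ((q : ℝ)⁻¹ ^ s * (1 - (q : ℝ)⁻¹)) / ((N : ℝ) * (1 - (q : ℝ)⁻¹ ^ m))

theorem tgcd_pos {q : ℕ} (hq : 1 < q) (m s : ℕ) : 0 < tgcd q m s :=
  Nat.gcd_pos_of_pos_right _ (by omega)

theorem tgcd_lt {q : ℕ} (hq : 1 < q) (m s : ℕ) : tgcd q m s < q :=
  lt_of_le_of_lt (Nat.gcd_le_right _ (by omega)) (by omega)

theorem inv_lt_one {q : ℕ} (hq : 1 < q) : (q : ℝ)⁻¹ < 1 :=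
  inv_lt_one_of_one_lt₀ (by exact_mod_cast hq)

theorem pointProb_nonneg {q m : ℕ} (hq : 1 < q) (N : ℕ) : 0 ≤ pointProb q m N := by
  have h1 := (inv_lt_one hq).le
  have h0 : (0 : ℝ) ≤ (q : ℝ)⁻¹ := by positivity
  have h2 : (0 : ℝ) ≤ 1 - (q : ℝ)⁻¹ ^ m := sub_nonneg.2 (pow_le_one₀ h0 h1)
  have h3 : (0 : ℝ) ≤ 1 - (q : ℝ)⁻¹ := sub_nonneg.2 h1
  unfold pointProb
  split_ifs
  · refine Finset.sum_nonneg fun s _ => mul_nonneg ?_ (by positivity)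
    have : (1 : ℝ) ≤ tgcd q m s := by exact_mod_cast tgcd_pos hq m s
    rw [sub_nonneg, div_le_one (by positivity)]
    exact this
  · exact Finset.sum_nonneg fun s _ => by positivity

theorem pointProb_sum {q m : ℕ} (hq : 1 < q) (hm : 0 < m) :
    ∑ N ∈ Finset.range q, pointProb q m N = 1 := by
  set w : ℕ → ℝ := fun s => ((q : ℝ)⁻¹ ^ s * (1 - (q : ℝ)⁻¹)) / (1 - (q : ℝ)⁻¹ ^ m) with hw
  have h0 : (0 : ℝ) ≤ (q : ℝ)⁻¹ := by positivity
  have hpow : (q : ℝ)⁻¹ ^ m < 1 := pow_lt_one₀ h0 (inv_lt_one hq) hm.ne'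
  have htot : ∑ s ∈ Finset.range m, w s = 1 := by
    have hd : (1 : ℝ) - (q : ℝ)⁻¹ ^ m ≠ 0 := (sub_pos.2 hpow).ne'
    have hgeom := geom_sum_mul_neg ((q : ℝ)⁻¹) m
    rw [hw, ← Finset.sum_div, ← Finset.sum_mul, hgeom, div_self hd]
  have hz : pointProb q m 0 = ∑ s ∈ Finset.range m, (1 - 1 / (tgcd q m s : ℝ)) * w s := by
    simp [pointProb, hw]
  have hpos : ∑ N ∈ (Finset.range q).erase 0, pointProb q m N =
      ∑ s ∈ Finset.range m, 1 / (tgcd q m s : ℝ) * w s := by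
    have hmaps : ∀ s ∈ Finset.range m, tgcd q m s ∈ (Finset.range q).erase 0 := fun s _ => by
      simp [tgcd_lt hq, (tgcd_pos hq m s).ne']
    rw [← Finset.sum_fiberwise_of_maps_to hmaps]
    refine Finset.sum_congr rfl fun N hN => ?_
    rw [pointProb, if_neg (Finset.ne_of_mem_erase hN)]
    refine Finset.sum_congr rfl fun s hs => ?_
    rw [(Finset.mem_filter.1 hs).2, hw, one_div, div_mul_eq_div_div_swap]
    ring
  rw [← Finset.add_sum_erase _ _ (Finset.mem_range.2 (by omega : 0 < q)), hz, hpos,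
    ← Finset.sum_add_distrib]
  refine Eq.trans ?_ htot
  exact Finset.sum_congr rfl fun s _ => by ring

theorem pointProb_eq_zero {q m : ℕ} (hq : 1 < q) (N : ℕ) (hN : N ∉ Finset.range q) :
    pointProb q m N = 0 := by
  have hN' : q ≤ N := by simpa using hN
  rw [pointProb, if_neg (by omega)]
  refine Finset.sum_eq_zero fun s hs => ?_
  have := tgcd_lt hq m s
  have := (Finset.mem_filter.1 hs).2
  omega

/-- The common law of the limiting random variables: the probability distribution on `ℕ` giving
mass `pointProb q m N` to `N`. -/
def pointLaw (q m : ℕ) (hq : 1 < q) (hm : 0 < m) : PMF ℕ :=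
  PMF.ofFinset (fun N => ENNReal.ofReal (pointProb q m N)) (Finset.range q)
    (by rw [← ENNReal.ofReal_sum_of_nonneg fun N _ => pointProb_nonneg hq N,
          pointProb_sum hq hm, ENNReal.ofReal_one])
    (fun N hN => by rw [pointProb_eq_zero hq N hN, ENNReal.ofReal_zero])

end Superelliptic

end

/-!
# Rational points on superelliptic curves and cyclic covers of the line

Over a rational point `a` of the line, write `f = (x - a) ^ s * u` with `u(a) ≠ 0`; here `s < m` as
`f` is free of `m`-th powers. Put `e = (m, s)`. Above `x = a` the function
`z = y ^ (m / e) / (x - a) ^ (s / e)` satisfies `z ^ e = u`, hence is regular on the normalization,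
and each rational point above `a` is determined by the value of `z`, which can be any `e`-th root of
`u(a)` in `F` (`nonempty_fibre_equiv`). Uniqueness is `exists_value`: a regular function is a
combination of terms `c y ^ k / h`, each of which is again integral, because it is an average of
conjugates (`isIntegral_coeff`, where `m` has to be invertible); and the `m`-th power of such a term
is a polynomial, so that the term either vanishes above `a` or is, near `a`, a power of `z` times a
function of `x`. Existence is lying over (`exists_prime_fibre`). So the number of rational points is
a sum over `a` of local contributions `localPoints`, which depend only on the local type `(s, u(a))`
(`numPoints_eq`).

For a prescription `τ` of local types at all rational points of the line, the polynomials of degree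
`d` and type `τ` are those in one residue class, and their number is known for large `d`
(`ncard_hasType`). Every nonzero polynomial is uniquely `g ^ m * h` with `g` monic and `h` free of
`m`-th powers; multiplication by `g ^ m` permutes the types if `g` has no root in `F`, and otherwise
yields none, as the orders are below `m`. So this factorization relates the densities of the various
types among power-free polynomials, and these densities tend to be proportional to
`∏ a, localWeight (τ a)` (`exists_typeDensity_sub_le`). A computation with cyclic groups
(`localPoints_eq`, `sum_localWeight_localPoints`) identifies the resulting law of the local
contributions with that of independent variables of law `pointLaw` (`measureReal_sum_eq`).

By Kummer theory over the rational functions on the line over an algebraic closure, the curve is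
geometrically integral unless `f` is a constant times a `p`-th power for a prime `p ∣ m`
(`geomIrreducible_of_forall_prime`), and such `f` have density zero. Hence neither irreducibility
condition affects the limit (`tendsto_proportion`).

If `F` contains the `m`-th roots of unity, the function field of an irreducible `C_f` is a cyclic
Kummer extension of `F(x)`, and the normalization is the integral closure of `F[x]` in it
(`isCyclicCover_normRing`). Conversely the function field of a cyclic cover is generated by an
`m`-th root of a polynomial, which can be taken free of `m`-th powers, and a normal cover is
recovered from its function field (`IsCyclicCover.exists_powerFree`).
-/

namespace Superelliptic

/-! ### Geometric irreducibility of superelliptic curves -/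

section Irreducibility

universe u

/-- The irreducibility criterion for `X ^ n - a` for every `n`, over a field containing a square
root of `-1` if `4 ∣ n`: the exceptional case `a = -4 b ^ 4` of the general criterion is then a
square. -/
theorem X_pow_sub_C_irreducible_of_forall_prime {K : Type u} [Field K] {n : ℕ} (hn : n ≠ 0)
    (hi : 4 ∣ n → ∃ i : K, i ^ 2 = -1) {a : K}
    (ha : ∀ p : ℕ, p.Prime → p ∣ n → ∀ b : K, b ^ p ≠ a) :
    Irreducible (X ^ n - C a) := by
  induction n using induction_on_primes generalizing K a with
  | zero => exact absurd rfl hn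
  | one => simpa using irreducible_X_sub_C a
  | prime_mul p n hp IH =>
    rw [mul_comm]
    apply X_pow_mul_sub_C_irreducible
      (X_pow_sub_C_irreducible_of_prime hp (ha p hp (dvd_mul_right _ _)))
    intro E _ _ x hx
    have hxi : IsIntegral K x := not_not.mp fun h ↦ by
      simpa only [degree_zero, degree_X_pow_sub_C hp.pos,
        WithBot.natCast_ne_bot] using congr_arg degree (hx.symm.trans (dif_neg h))
    refine IH (right_ne_zero_of_mul hn) (fun h4 => ?_) ?_
    · obtain ⟨i, hi⟩ := hi (h4.mul_left p)
      exact ⟨algebraMap K _ i, by rw [← map_pow, hi, map_neg, map_one]⟩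
    intro q hq hqn b hb
    have hnorm : (Algebra.norm K b) ^ q = (-1) ^ p * (-a) := by
      rw [← map_pow, hb, ← IntermediateField.adjoin.powerBasis_gen hxi,
        Algebra.PowerBasis.norm_gen_eq_coeff_zero_minpoly]
      simp [IntermediateField.minpoly_gen, hx, hp.ne_zero.symm]
    rcases hp.eq_two_or_odd' with rfl | hodd
    · rw [neg_one_sq, one_mul] at hnorm
      rcases hq.eq_two_or_odd' with rfl | hqodd
      · -- here `-a` is a square, and so is `-1`
        obtain ⟨i, hi⟩ := hi (mul_dvd_mul_left 2 hqn)
        exact ha 2 hq (dvd_mul_right _ _) (i * Algebra.norm K b)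
          (by rw [mul_pow, hnorm, hi]; ring)
      · exact ha q hq (hqn.mul_left 2) (-Algebra.norm K b) (by rw [hqodd.neg_pow, hnorm, neg_neg])
    · exact ha q hq (hqn.mul_left p) (Algebra.norm K b)
        (by rw [hnorm, hodd.neg_one_pow]; ring)

variable {F : Type*} [Field F]

theorem monic_eq_of_pow_eq {n : ℕ} (hn : n ≠ 0) {g h : F[X]} (hg : g.Monic) (hh : h.Monic)
    (e : g ^ n = h ^ n) : g = h :=
  Polynomial.eq_of_monic_of_associated hg hh <|
    associated_of_dvd_dvd ((IsIntegrallyClosed.pow_dvd_pow_iff hn).1 e.dvd)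
      ((IsIntegrallyClosed.pow_dvd_pow_iff hn).1 e.symm.dvd)

/-- Being a constant multiple of a `p`-th power descends from the algebraic closure: a monic
`p`-th root is unique, hence fixed by Galois. -/
theorem exists_eq_C_mul_pow_of_map [PerfectField F] {p : ℕ} (hp : p ≠ 0) {f : F[X]} (hf : f ≠ 0)
    {h : (AlgebraicClosure F)[X]} (e : h ^ p = f.map (algebraMap F (AlgebraicClosure F))) :
    ∃ (c : F) (g : F[X]), f = C c * g ^ p := by
  set ι := algebraMap F (AlgebraicClosure F)
  have hh : h ≠ 0 := by
    rintro rfl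
    rw [zero_pow hp, eq_comm, Polynomial.map_eq_zero] at e
    exact hf e
  set h₁ := h * C h.leadingCoeff⁻¹ with hh₁
  have hm : h₁.Monic := monic_mul_leadingCoeff_inv hh
  have e₁ : h₁ ^ p = (f * C f.leadingCoeff⁻¹).map ι := by
    have hl : ι f.leadingCoeff = h.leadingCoeff ^ p := by
      rw [← leadingCoeff_pow, e, Polynomial.leadingCoeff_map]
    rw [hh₁, mul_pow, e, Polynomial.map_mul, Polynomial.map_C, map_inv₀ ι, hl, ← C_pow, inv_pow]
  have hfix : ∀ σ : Gal(AlgebraicClosure F/F), h₁.map (σ : AlgebraicClosure F →+* _) = h₁ := by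
    intro σ
    refine monic_eq_of_pow_eq hp (hm.map _) hm ?_
    rw [← Polynomial.map_pow, e₁, Polynomial.map_map]
    congr 1
    ext x
    simp [ι]
  have hlift : h₁ ∈ Polynomial.lifts ι := by
    rw [Polynomial.lifts_iff_coeff_lifts]
    intro n
    have : h₁.coeff n ∈ (⊥ : IntermediateField F (AlgebraicClosure F)) := by
      rw [InfiniteGalois.mem_bot_iff_fixed]
      intro σ
      have := congrArg (fun q => q.coeff n) (hfix σ)
      simpa using this
    exact IntermediateField.mem_bot.1 this
  obtain ⟨g, hg⟩ := (Polynomial.mem_lifts _).1 hlift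
  refine ⟨f.leadingCoeff, g, ?_⟩
  have : f * C f.leadingCoeff⁻¹ = g ^ p := by
    apply Polynomial.map_injective ι ι.injective
    rw [← e₁, Polynomial.map_pow, hg]
  rw [← this, mul_comm (f : F[X]), ← mul_assoc, ← C_mul,
    mul_inv_cancel₀ (leadingCoeff_ne_zero.2 hf), C_1, one_mul]

/-- If no prime `p ∣ m` makes `f` a constant multiple of a `p`-th power, then `y ^ m - f` is
a prime element of `Fc[x][y]`, where `Fc` is an algebraic closure of the base field. -/
theorem prime_X_pow_sub_C_map [PerfectField F] {m : ℕ} (hm : m ≠ 0) {f : F[X]} (hf : f ≠ 0)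
    (hpow : ∀ p : ℕ, p.Prime → p ∣ m → ∀ (c : F) (g : F[X]), f ≠ C c * g ^ p) :
    Prime (X ^ m - C (f.map (algebraMap F (AlgebraicClosure F))) :
      (AlgebraicClosure F)[X][X]) := by
  set Fc := AlgebraicClosure F
  set f' := f.map (algebraMap F Fc) with hf'
  have hmon : (X ^ m - C f' : Fc[X][X]).Monic := monic_X_pow_sub_C _ hm
  rw [← UniqueFactorizationMonoid.irreducible_iff_prime,
    hmon.irreducible_iff_irreducible_map_fraction_map (K := FractionRing Fc[X])]
  simp only [Polynomial.map_sub, Polynomial.map_pow, map_X, map_C]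
  refine X_pow_sub_C_irreducible_of_forall_prime hm (fun _ => ?_) ?_
  · obtain ⟨i, hi⟩ := IsAlgClosed.exists_pow_nat_eq (-1 : Fc) two_pos
    exact ⟨algebraMap Fc[X] _ (C i), by rw [← map_pow, ← C_pow, hi]; simp⟩
  · intro p hp hpm b hb
    obtain ⟨h, rfl⟩ := IsIntegrallyClosed.exists_algebraMap_eq_of_isIntegral_pow
      (R := Fc[X]) hp.pos (x := b) (by rw [hb]; exact isIntegral_algebraMap)
    rw [← map_pow] at hb
    obtain ⟨c, g, h⟩ := exists_eq_C_mul_pow_of_map hp.ne_zero hf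
      (IsFractionRing.injective Fc[X] (FractionRing Fc[X]) hb)
    exact hpow p hp hpm c g h

end Irreducibility

section Geometric

variable {F : Type*} [Field F]

theorem prime_of_prime_map_equiv {R S : Type*} [CommRing R] [CommRing S] (e : R ≃+* S) {p : R[X]}
    (h : Prime (p.map e.toRingHom)) : Prime p :=
  (MulEquiv.prime_iff (Polynomial.mapEquiv e).toMulEquiv).1 h

theorem isDomain_tensor_coordRing {m : ℕ} {f : F[X]}
    (h : Prime (X ^ m - C (f.map (algebraMap F (AlgebraicClosure F))) :
      (AlgebraicClosure F)[X][X])) :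
    IsDomain (AlgebraicClosure F ⊗[F] CoordRing m f) := by
  set Fc := AlgebraicClosure F
  set q : (Fc ⊗[F] F[X])[X] := (X ^ m - C f : F[X][X]).map
    (Algebra.TensorProduct.includeRight : F[X] →ₐ[F] Fc ⊗[F] F[X]).toRingHom with hq
  let e : (Fc ⊗[F] F[X]) ≃ₐ[Fc] Fc[X] := (polyEquivTensor' F Fc).symm
  have hqp : Prime q := by
    refine prime_of_prime_map_equiv e.toRingEquiv ?_
    convert h
    simp only [hq, Polynomial.map_sub, Polynomial.map_pow, map_X, map_C]
    congr 2
    simp only [RingEquiv.toRingHom_eq_coe, RingHom.coe_coe,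
      AlgHom.toRingHom_eq_coe, Algebra.TensorProduct.includeRight_apply, e]
    simp
    rfl
  have := AdjoinRoot.isDomain_of_prime hqp
  exact (AdjoinRoot.tensorAlgEquiv (T := Fc) (X ^ m - C f : F[X][X]) q rfl).toMulEquiv.isDomain

theorem isDomain_tensor_fractionRing {Fc A : Type*} [Field Fc] [Algebra F Fc] [CommRing A]
    [Algebra F A] [IsDomain A] [IsDomain (Fc ⊗[F] A)] :
    IsDomain (Fc ⊗[F] FractionRing A) := by
  let : Algebra (Fc ⊗[F] A) (Fc ⊗[F] FractionRing A) :=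
    (Algebra.TensorProduct.map (AlgHom.id F Fc) (IsScalarTower.toAlgHom F _ _)).toAlgebra
  have : IsScalarTower Fc (Fc ⊗[F] A) (Fc ⊗[F] FractionRing A) :=
    .of_algebraMap_eq <| by intro; simp [RingHom.algebraMap_toAlgebra]
  have := IsLocalization.tensorProduct_tensorProduct_right F Fc (nonZeroDivisors A) (FractionRing A)
    (by ext; simp [RingHom.algebraMap_toAlgebra])
  refine IsLocalization.isDomain_of_le_nonZeroDivisors (R := Fc ⊗[F] A)
    (Fc ⊗[F] FractionRing A)
    (M := (nonZeroDivisors A).map (Algebra.TensorProduct.includeRight (R := F) (A := Fc))) ?_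
  rintro _ ⟨a, ha, rfl⟩
  refine mem_nonZeroDivisors_of_ne_zero fun h => nonZeroDivisors.ne_zero ha ?_
  exact Algebra.TensorProduct.includeRight_injective (algebraMap F Fc).injective
    (h.trans (map_zero _).symm)

/-- If the base change of `C_f` to the algebraic closure is integral then so is that of every
ring between the coordinate ring of `C_f` and its fraction field. -/
theorem isDomain_tensor_normRing {m : ℕ} {f : F[X]}
    (h : IsDomain (AlgebraicClosure F ⊗[F] CoordRing m f)) :
    IsDomain (CoordRing m f) ∧ IsDomain (AlgebraicClosure F ⊗[F] NormRing m f) := by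
  have hA : IsDomain (CoordRing m f) :=
    (Algebra.TensorProduct.includeRight_injective (R := F) (A := AlgebraicClosure F)
      (B := CoordRing m f) (algebraMap F _).injective).isDomain
      (Algebra.TensorProduct.includeRight (R := F) (A := AlgebraicClosure F)
        (B := CoordRing m f)).toRingHom
  refine ⟨hA, ?_⟩
  have := isDomain_tensor_fractionRing (F := F) (Fc := AlgebraicClosure F) (A := CoordRing m f)
  let φ : NormRing m f →ₐ[F] FractionRing (CoordRing m f) :=
    (Subalgebra.val _).restrictScalars F
  have hφ : Function.Injective φ := Subtype.val_injective
  exact (Module.Flat.lTensor_preserves_injective_linearMap (M := AlgebraicClosure F)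
    φ.toLinearMap hφ).isDomain
    (Algebra.TensorProduct.map (AlgHom.id F (AlgebraicClosure F)) φ).toRingHom

/-- The curve `C_f` is geometrically integral unless `f` is a constant multiple of a proper power
dividing `m`. -/
theorem geomIrreducible_of_forall_prime [PerfectField F] {m : ℕ} (hm : m ≠ 0) {f : F[X]}
    (hf : f ≠ 0)
    (hpow : ∀ p : ℕ, p.Prime → p ∣ m → ∀ (c : F) (g : F[X]), f ≠ C c * g ^ p) :
    IsDomain (CoordRing m f) ∧ NormIrreducible m f ∧ NormGeomIrreducible m f := by
  obtain ⟨h₁, h₂⟩ := isDomain_tensor_normRing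
    (isDomain_tensor_coordRing (prime_X_pow_sub_C_map hm hf hpow))
  refine ⟨h₁, ?_, ?_⟩
  · unfold NormIrreducible
    infer_instance
  · unfold NormGeomIrreducible
    infer_instance

end Geometric

/-! ### Counting polynomials and removing powers -/

section Counting

variable {F : Type*} [Field F]

theorem finite_degree_lt [Finite F] (n : ℕ) : {f : F[X] | f.degree < n}.Finite := by
  have : Finite (degreeLT F n) := Finite.of_equiv _ (degreeLTEquiv F n).symm.toEquiv
  refine Set.Finite.subset (Set.toFinite (degreeLT F n : Set F[X])) fun f hf => ?_
  exact mem_degreeLT.2 hf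

theorem finite_degree_eq [Finite F] (n : ℕ) : {f : F[X] | f.degree = n}.Finite :=
  (finite_degree_lt (n + 1)).subset fun f (hf : f.degree = n) => by
    rw [Set.mem_ofPred_eq, hf]; exact_mod_cast n.lt_succ_self

variable [Fintype F]

theorem ncard_degree_lt (n : ℕ) : {f : F[X] | f.degree < n}.ncard = Fintype.card F ^ n := by
  have : {f : F[X] | f.degree < n} = (degreeLT F n : Set F[X]) := by
    ext f; exact mem_degreeLT.symm
  rw [this, ← Nat.card_coe_set_eq]
  refine (Nat.card_congr (degreeLTEquiv F n).toEquiv).trans ?_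
  simp

theorem ncard_degree_eq (n : ℕ) :
    ({f : F[X] | f.degree = n}.ncard : ℝ) = (Fintype.card F - 1) * (Fintype.card F : ℝ) ^ n := by
  have h : {f : F[X] | f.degree < (n + 1 : ℕ)} = {f : F[X] | f.degree < n} ∪ {f : F[X] | f.degree = n} := by
    ext f
    simp only [Set.mem_ofPred_eq, Set.mem_union]
    rcases eq_or_ne f 0 with rfl | hf
    · simp
    · rw [degree_eq_natDegree hf]
      norm_cast
      omega
  have hd : Disjoint {f : F[X] | f.degree < n} {f | f.degree = n} :=
    Set.disjoint_left.2 fun f (h₁ : f.degree < n) (h₂ : f.degree = n) => by simp [h₂] at h₁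
  have := Set.ncard_union_eq hd (finite_degree_lt n) (finite_degree_eq n)
  rw [← h, ncard_degree_lt, ncard_degree_lt] at this
  have h' : (Fintype.card F : ℝ) ^ (n + 1) =
      (Fintype.card F : ℝ) ^ n + ({f : F[X] | f.degree = n}.ncard : ℝ) := by exact_mod_cast this
  rw [pow_succ] at h'
  linarith

theorem ncard_monic_le (n : ℕ) :
    {f : F[X] | f.Monic ∧ f.natDegree = n}.ncard ≤ Fintype.card F ^ n := by
  rw [← ncard_degree_lt]
  refine Set.ncard_le_ncard_of_injOn (fun f => f - X ^ n) ?_ ?_ (finite_degree_lt n)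
  · rintro f ⟨hf, rfl⟩
    rw [Set.mem_ofPred_eq, ← degree_eq_natDegree hf.ne_zero]
    refine degree_sub_lt_left ?_ hf.ne_zero (by simp [hf.leadingCoeff])
    rw [degree_X_pow, degree_eq_natDegree hf.ne_zero]
  · intro f _ g _ h
    simpa using h

/-- The monic polynomials `g` such that `g ^ m` has degree at most `n`. -/
noncomputable def monicUpTo (F : Type*) [Field F] [Fintype F] (m n : ℕ) (hm : m ≠ 0) :
    Finset F[X] :=
  Set.Finite.toFinset (s := {g : F[X] | g.Monic ∧ m * g.natDegree ≤ n}) <|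
    (finite_degree_lt (n + 1)).subset fun g hg => by
      rw [Set.mem_ofPred_eq, degree_eq_natDegree hg.1.ne_zero]
      have : g.natDegree ≤ m * g.natDegree := Nat.le_mul_of_pos_left _ (Nat.pos_of_ne_zero hm)
      have := hg.2
      exact_mod_cast (by omega : g.natDegree < n + 1)

theorem mem_monicUpTo {m n : ℕ} {hm : m ≠ 0} {g : F[X]} :
    g ∈ monicUpTo F m n hm ↔ g.Monic ∧ m * g.natDegree ≤ n := by
  simp [monicUpTo]

open Classical in
theorem sum_monicUpTo_le {m n : ℕ} (hm : m ≠ 0) {w r : ℝ} (hw : 0 ≤ w)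
    (hr : Fintype.card F * w ≤ r) (hr1 : r < 1) :
    ∑ g ∈ (monicUpTo F m n hm).erase 1, w ^ g.natDegree ≤ r / (1 - r) := by
  have hr0 : 0 ≤ r := le_trans (by positivity) hr
  have hmaps : ∀ g ∈ (monicUpTo F m n hm).erase 1, g.natDegree - 1 ∈ Finset.range n := by
    intro g hg
    rw [Finset.mem_erase, mem_monicUpTo] at hg
    have h0 : g.natDegree ≠ 0 := fun h => hg.1 (hg.2.1.natDegree_eq_zero.1 h)
    have : g.natDegree ≤ m * g.natDegree := Nat.le_mul_of_pos_left _ (Nat.pos_of_ne_zero hm)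
    have := hg.2.2
    rw [Finset.mem_range]
    omega
  rw [← Finset.sum_fiberwise_of_maps_to hmaps]
  calc _ ≤ ∑ j ∈ Finset.range n, r * r ^ j := by
        refine Finset.sum_le_sum fun j _ => ?_
        set S := ((monicUpTo F m n hm).erase 1).filter fun g => g.natDegree - 1 = j
        have hdeg : ∀ g ∈ S, g.Monic ∧ g.natDegree = j + 1 := by
          intro g hg
          rw [Finset.mem_filter, Finset.mem_erase, mem_monicUpTo] at hg
          have h0 : g.natDegree ≠ 0 :=
            fun h => hg.1.1 (hg.1.2.1.natDegree_eq_zero.1 h)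
          exact ⟨hg.1.2.1, by omega⟩
        have hcard : S.card ≤ Fintype.card F ^ (j + 1) := by
          rw [← Set.ncard_coe_finset]
          refine (Set.ncard_le_ncard (fun g hg => hdeg g hg) ?_).trans (ncard_monic_le (j + 1))
          refine (finite_degree_eq (j + 1)).subset fun g hg => ?_
          rw [Set.mem_ofPred_eq, degree_eq_natDegree hg.1.ne_zero, hg.2]
        rw [Finset.sum_congr rfl fun g hg => by rw [(hdeg g hg).2], Finset.sum_const, nsmul_eq_mul]
        calc (S.card : ℝ) * w ^ (j + 1) ≤ (Fintype.card F : ℝ) ^ (j + 1) * w ^ (j + 1) := by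
              gcongr; exact_mod_cast hcard
          _ = (Fintype.card F * w) ^ (j + 1) := (mul_pow _ _ _).symm
          _ ≤ r ^ (j + 1) := by gcongr
          _ = r * r ^ j := pow_succ' _ _
    _ = r * ∑ j ∈ Finset.range n, r ^ j := by rw [Finset.mul_sum]
    _ ≤ r / (1 - r) := by
        rw [div_eq_mul_inv]
        refine mul_le_mul_of_nonneg_left ?_ hr0
        rw [← tsum_geometric_of_lt_one hr0 hr1]
        exact (summable_geometric_of_lt_one hr0 hr1).sum_le_tsum _ fun i _ => by positivity

end Counting

section PowerFreePart

variable {F : Type*} [Field F] {m : ℕ}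

theorem PowerFree.ne_zero {f : F[X]} (hf : PowerFree m f) : f ≠ 0 := by
  rintro rfl
  exact not_isUnit_X (hf X (dvd_zero _))

/-- Every nonzero polynomial is the product of an `m`-th power and an `m`-th power-free one. -/
theorem exists_powerFree_part (hm : m ≠ 0) {f : F[X]} (hf : f ≠ 0) :
    ∃ g h : F[X], g.Monic ∧ PowerFree m h ∧ f = g ^ m * h := by
  induction hn : f.natDegree using Nat.strong_induction_on generalizing f with
  | _ n IH =>
    by_cases hpf : PowerFree m f
    · exact ⟨1, f, monic_one, hpf, by simp⟩
    simp only [PowerFree, not_forall] at hpf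
    obtain ⟨g, ⟨k, rfl⟩, hgu⟩ := hpf
    have hg : g ≠ 0 := by rintro rfl; simp [hm] at hf
    have hk : k ≠ 0 := right_ne_zero_of_mul hf
    have hgd : 0 < g.natDegree := Nat.pos_of_ne_zero fun h0 => hgu <|
      isUnit_iff_degree_eq_zero.2 (by rw [degree_eq_natDegree hg, h0]; rfl)
    have hlt : k.natDegree < n := by
      rw [← hn, natDegree_mul (pow_ne_zero _ hg) hk, natDegree_pow]
      have : 0 < m * g.natDegree := Nat.mul_pos (Nat.pos_of_ne_zero hm) hgd
      omega
    obtain ⟨g', h, hg', hh, rfl⟩ := IH _ hlt hk rfl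
    have hl : g.leadingCoeff ≠ 0 := leadingCoeff_ne_zero.2 hg
    refine ⟨g * C g.leadingCoeff⁻¹ * g', C (g.leadingCoeff ^ m) * h,
      (monic_mul_leadingCoeff_inv hg).mul hg', fun p hp => hh p ?_, ?_⟩
    · rwa [(isUnit_C.2 (IsUnit.mk0 _ (pow_ne_zero m hl))).dvd_mul_left] at hp
    · have : (C g.leadingCoeff⁻¹ : F[X]) ^ m * C (g.leadingCoeff ^ m) = 1 := by
        rw [← C_pow, ← C_mul, inv_pow, inv_mul_cancel₀ (pow_ne_zero m hl), C_1]
      linear_combination (-(g ^ m * g' ^ m * h)) * this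

theorem powerFree_part_unique {g₁ g₂ h₁ h₂ : F[X]} (hg₁ : g₁.Monic)
    (hg₂ : g₂.Monic) (hh₁ : PowerFree m h₁) (hh₂ : PowerFree m h₂)
    (e : g₁ ^ m * h₁ = g₂ ^ m * h₂) : g₁ = g₂ := by
  classical
  have key : ∀ {g₁ g₂ h₁ h₂ : F[X]}, g₁ ≠ 0 → PowerFree m h₂ →
      g₁ ^ m * h₁ = g₂ ^ m * h₂ → g₁ ∣ g₂ := by
    intro g₁ g₂ h₁ h₂ hg₁ hh₂ e
    obtain ⟨a, ha⟩ := EuclideanDomain.gcd_dvd_left g₁ g₂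
    obtain ⟨b, hb⟩ := EuclideanDomain.gcd_dvd_right g₁ g₂
    set d := EuclideanDomain.gcd g₁ g₂
    have hd : d ≠ 0 := by
      intro h
      rw [h, zero_mul] at ha
      exact hg₁ ha
    have hcop : IsCoprime a b := by
      obtain ⟨u, v, huv⟩ : ∃ u v, d = g₁ * u + g₂ * v := ⟨_, _, EuclideanDomain.gcd_eq_gcd_ab _ _⟩
      refine ⟨u, v, mul_left_cancel₀ hd ?_⟩
      calc d * (u * a + v * b) = (d * a) * u + (d * b) * v := by ring
        _ = d * 1 := by rw [← ha, ← hb, ← huv, mul_one]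
    have e' : a ^ m * h₁ = b ^ m * h₂ := by
      refine mul_left_cancel₀ (pow_ne_zero m hd) ?_
      rw [← mul_assoc, ← mul_assoc, ← mul_pow, ← mul_pow, ← ha, ← hb, e]
    have hu : IsUnit a := hh₂ a ((hcop.pow (m := m) (n := m)).dvd_of_dvd_mul_left ⟨h₁, e'.symm⟩)
    rw [ha, hb]
    exact mul_dvd_mul_left d hu.dvd
  exact eq_of_monic_of_associated hg₁ hg₂ <|
    associated_of_dvd_dvd (key hg₁.ne_zero hh₂ e) (key hg₂.ne_zero hh₁ e.symm)

end PowerFreePart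

/-! ### Local types of a polynomial at the points of the line -/

section LocalType

variable {F : Type*} [Field F] {m : ℕ}

/-- `f` has local type `τ` if at every `a : F` it is `v (x - a) ^ s` to leading order, where
`(s, v) = τ a` records the order of vanishing `s < m` and the leading coefficient `v ≠ 0`. -/
def HasType (f : F[X]) (τ : F → Fin m × Fˣ) : Prop :=
  ∀ a, (X - C a) ^ ((τ a).1 + 1 : ℕ) ∣ f - C ((τ a).2 : F) * (X - C a) ^ ((τ a).1 : ℕ)

theorem HasType.exists_eq {f : F[X]} {τ : F → Fin m × Fˣ} (h : HasType f τ) (a : F) :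
    ∃ u : F[X], f = (X - C a) ^ ((τ a).1 : ℕ) * u ∧ u.eval a = (τ a).2 := by
  obtain ⟨k, hk⟩ := h a
  refine ⟨C ((τ a).2 : F) + (X - C a) * k, ?_, by simp⟩
  rw [sub_eq_iff_eq_add] at hk
  rw [hk]
  ring

theorem HasType.rootMultiplicity_eq {f : F[X]} {τ : F → Fin m × Fˣ} (h : HasType f τ) (a : F) :
    f.rootMultiplicity a = (τ a).1 := by
  obtain ⟨u, rfl, hu⟩ := h.exists_eq a
  have hu0 : u.eval a ≠ 0 := by rw [hu]; exact (τ a).2.ne_zero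
  have : u ≠ 0 := by rintro rfl; simp at hu0
  rw [rootMultiplicity_mul (mul_ne_zero (pow_ne_zero _ (X_sub_C_ne_zero a)) this),
    rootMultiplicity_X_sub_C_pow, rootMultiplicity_eq_zero hu0, add_zero]

theorem HasType.unique {f : F[X]} {τ τ' : F → Fin m × Fˣ} (h : HasType f τ) (h' : HasType f τ') :
    τ = τ' := by
  funext a
  have h1 : (τ a).1 = (τ' a).1 :=
    Fin.ext ((h.rootMultiplicity_eq a).symm.trans (h'.rootMultiplicity_eq a))
  obtain ⟨u, hu, hua⟩ := h.exists_eq a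
  obtain ⟨u', hu', hua'⟩ := h'.exists_eq a
  rw [← h1, hu] at hu'
  have := mul_left_cancel₀ (pow_ne_zero _ (X_sub_C_ne_zero a)) hu'
  rw [this, hua'] at hua
  exact Prod.ext h1 (Units.ext hua.symm)

theorem PowerFree.exists_hasType {f : F[X]} (hf : PowerFree m f) :
    ∃ τ : F → Fin m × Fˣ, HasType f τ := by
  have : ∀ a, ∃ p : Fin m × Fˣ,
      (X - C a) ^ (p.1 + 1 : ℕ) ∣ f - C (p.2 : F) * (X - C a) ^ (p.1 : ℕ) := by
    intro a
    obtain ⟨u, hu, hua⟩ := exists_eq_pow_rootMultiplicity_mul_and_not_dvd f hf.ne_zero a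
    have hlt : f.rootMultiplicity a < m := by
      by_contra! hle
      exact not_isUnit_X_sub_C a (hf _ ((pow_dvd_pow _ hle).trans ⟨u, hu⟩))
    rw [dvd_iff_isRoot, IsRoot] at hua
    refine ⟨(⟨_, hlt⟩, Units.mk0 _ hua), ?_⟩
    obtain ⟨k, hk⟩ : X - C a ∣ u - C (u.eval a) := dvd_iff_isRoot.2 (by simp)
    refine ⟨k, ?_⟩
    simp only [Units.val_mk0]
    calc f - C (u.eval a) * (X - C a) ^ f.rootMultiplicity a
        = (X - C a) ^ f.rootMultiplicity a * (u - C (u.eval a)) := by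
          conv_lhs => enter [1]; rw [hu]
          ring
      _ = _ := by rw [hk]; ring
  choose τ hτ using this
  exact ⟨τ, hτ⟩

/-- The type of the cofactor when a factor with values `c a` is divided out. -/
def divType (τ : F → Fin m × Fˣ) (c : F → Fˣ) : F → Fin m × Fˣ :=
  fun a => ((τ a).1, (τ a).2 / c a)

theorem hasType_mul_iff {g h : F[X]} {τ : F → Fin m × Fˣ} {c : F → Fˣ}
    (hc : ∀ a, g.eval a = c a) : HasType (g * h) τ ↔ HasType h (divType τ c) := by
  refine forall_congr' fun a => ?_
  set s : ℕ := ((τ a).1 : ℕ)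
  set v : F := ((τ a).2 : F)
  have hv : (((divType τ c a).2 : Fˣ) : F) = v / c a := by simp [divType, v]
  change (X - C a) ^ (s + 1) ∣ g * h - C v * (X - C a) ^ s ↔
    (X - C a) ^ (s + 1) ∣ h - C (((divType τ c a).2 : Fˣ) : F) * (X - C a) ^ s
  rw [hv]
  obtain ⟨k, hk⟩ : X - C a ∣ g - C (c a : F) := dvd_iff_isRoot.2 (by simp [hc])
  have hvc : (C v : F[X]) = C (c a : F) * C (v / c a) := by
    rw [← C_mul, mul_div_cancel₀ _ (c a).ne_zero]
  have key : g * h - C v * (X - C a) ^ s = g * (h - C (v / c a) * (X - C a) ^ s) +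
      (X - C a) ^ (s + 1) * (C (v / c a) * k) := by
    rw [hvc]
    linear_combination (C (v / c a) * (X - C a) ^ s) * hk
  have hcop : IsCoprime ((X - C a) ^ (s + 1)) g := by
    refine IsCoprime.pow_left ?_
    rw [(prime_X_sub_C a).coprime_iff_not_dvd, dvd_iff_isRoot, IsRoot, hc]
    exact (c a).ne_zero
  rw [key, dvd_add_left (dvd_mul_right _ _)]
  exact ⟨hcop.dvd_of_dvd_mul_left, fun h => h.mul_left g⟩

/-- The degree of the modulus of the congruence condition `HasType`. -/
def typeDegree [Fintype F] (τ : F → Fin m × Fˣ) : ℕ := ∑ a, ((τ a).1 + 1 : ℕ)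

/-- By the Chinese remainder theorem the polynomials of a given local type form a residue class,
so they are equidistributed among the polynomials of large degree. -/
theorem ncard_hasType [Fintype F] (τ : F → Fin m × Fˣ) {n : ℕ} (hn : typeDegree τ ≤ n) :
    ({f : F[X] | f.degree = n ∧ HasType f τ}.ncard : ℝ) * (Fintype.card F : ℝ) ^ typeDegree τ =
      (Fintype.card F - 1) * (Fintype.card F : ℝ) ^ n := by
  classical
  set t : F → F[X] := fun a => (X - C a) ^ ((τ a).1 + 1 : ℕ) with ht
  set M : F[X] := ∏ a, t a with hM
  have hmon : ∀ a, (t a).Monic := fun a => (monic_X_sub_C a).pow _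
  have hMm : M.Monic := monic_prod_of_monic _ _ fun a _ => hmon a
  have hMd : M.natDegree = typeDegree τ := by
    rw [hM, natDegree_prod_of_monic _ _ fun a _ => hmon a]
    simp [ht, typeDegree]
  have hcop : Pairwise fun a b => IsCoprime (t a) (t b) := fun a b hab =>
    (pairwise_coprime_X_sub_C Function.injective_id hab).pow
  obtain ⟨r, hr⟩ : ∃ r : F[X], ∀ a, t a ∣ r - C ((τ a).2 : F) * (X - C a) ^ ((τ a).1 : ℕ) := by
    obtain ⟨r, hr⟩ := Ideal.exists_forall_sub_mem_ideal (I := fun a => Ideal.span {t a})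
      (fun a b hab => (Ideal.isCoprime_span_singleton_iff _ _).2 (hcop hab))
      (fun a => C ((τ a).2 : F) * (X - C a) ^ ((τ a).1 : ℕ))
    exact ⟨r, fun a => Ideal.mem_span_singleton.1 (hr a)⟩
  have hiff : ∀ f : F[X], HasType f τ ↔ M ∣ f - r %ₘ M := by
    intro f
    have h1 : M ∣ r - r %ₘ M := ⟨r /ₘ M, by
      rw [sub_eq_iff_eq_add, add_comm]; exact (modByMonic_add_div r M).symm⟩
    have h2 : M ∣ f - r %ₘ M ↔ M ∣ f - r := by
      rw [← dvd_add_left h1 (a := M) (b := f - r)]; ring_nf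
    rw [h2, hM]
    refine Iff.trans (forall_congr' fun a => ?_) ⟨fun h => Finset.prod_dvd_of_coprime
      (fun a _ b _ hab => hcop hab) fun a _ => h a,
      fun h a => (Finset.dvd_prod_of_mem t (Finset.mem_univ a)).trans h⟩
    rw [← dvd_sub_left (hr a) (a := t a)]
    ring_nf
  have hdegr : (r %ₘ M).degree < M.degree := degree_modByMonic_lt _ hMm
  have himg : {f : F[X] | f.degree = n ∧ HasType f τ} =
      (fun h => M * h + r %ₘ M) '' {h : F[X] | h.degree = (n - typeDegree τ : ℕ)} := by
    have hdeg : ∀ h : F[X], h ≠ 0 →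
        (M * h + r %ₘ M).degree = (typeDegree τ + h.natDegree : ℕ) := by
      intro h hh
      have h1 : (M * h).degree = (typeDegree τ + h.natDegree : ℕ) := by
        rw [degree_mul, degree_eq_natDegree hMm.ne_zero, degree_eq_natDegree hh, hMd]
        norm_cast
      rw [← h1]
      refine degree_add_eq_left_of_degree_lt (hdegr.trans_le ?_)
      rw [h1, degree_eq_natDegree hMm.ne_zero, hMd]
      exact_mod_cast Nat.le_add_right _ _
    ext f
    simp only [Set.mem_ofPred_eq, Set.mem_image, hiff]
    constructor
    · rintro ⟨hfd, h, hh⟩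
      have hf : f = M * h + r %ₘ M := by rw [← hh]; ring
      refine ⟨h, ?_, hf.symm⟩
      have hh0 : h ≠ 0 := by
        rintro rfl
        rw [hf, mul_zero, zero_add] at hfd
        rw [hfd, degree_eq_natDegree hMm.ne_zero, hMd] at hdegr
        exact absurd hdegr (by exact_mod_cast hn.not_gt)
      rw [hf, hdeg h hh0] at hfd
      have : typeDegree τ + h.natDegree = n := by exact_mod_cast hfd
      rw [degree_eq_natDegree hh0]
      norm_cast
      omega
    · rintro ⟨h, hhd, rfl⟩
      have hh0 : h ≠ 0 := by rintro rfl; simp at hhd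
      refine ⟨?_, h, by ring⟩
      rw [hdeg h hh0, natDegree_eq_of_degree_eq_some hhd]
      norm_cast
      omega
  have hinj : Function.Injective fun h => M * h + r %ₘ M := fun h₁ h₂ h =>
    mul_left_cancel₀ hMm.ne_zero (add_right_cancel h)
  rw [himg, Set.ncard_image_of_injective _ hinj, ncard_degree_eq, mul_assoc, ← pow_add,
    Nat.sub_add_cancel hn]

end LocalType

/-! ### Equidistribution of local types among power-free polynomials -/

section Equidistribution

variable {F : Type*} [Field F] {m : ℕ}

theorem degree_pow_mul_eq_iff {g h : F[X]} {n : ℕ} (hg : g ≠ 0) (hn : m * g.natDegree ≤ n) :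
    (g ^ m * h).degree = n ↔ h.degree = (n - m * g.natDegree : ℕ) := by
  rcases eq_or_ne h 0 with rfl | hh
  · simp
  rw [degree_eq_natDegree (mul_ne_zero (pow_ne_zero _ hg) hh), degree_eq_natDegree hh,
    natDegree_mul (pow_ne_zero _ hg) hh, natDegree_pow]
  norm_cast
  omega

variable [Fintype F]

/-- The number of `m`-th power-free polynomials of degree `n` and local type `τ`, divided by its
expected order of magnitude. -/
noncomputable def typeDensity (τ : F → Fin m × Fˣ) (n : ℕ) : ℝ :=
  (Fintype.card F : ℝ) ^ typeDegree τ *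
    {f : F[X] | f.degree = n ∧ HasType f τ ∧ PowerFree m f}.ncard / (Fintype.card F : ℝ) ^ n

/-- The contribution to the count of polynomials of degree `n` and local type `τ` of those with
`m`-th power part `g ^ m`, with the same normalization as `typeDensity`. -/
noncomputable def partDensity (g : F[X]) (τ : F → Fin m × Fˣ) (n : ℕ) : ℝ :=
  (Fintype.card F : ℝ) ^ typeDegree τ *
    {f : F[X] | f.degree = n ∧ HasType f τ ∧ ∃ h, PowerFree m h ∧ f = g ^ m * h}.ncard /
      (Fintype.card F : ℝ) ^ n

theorem cardF_pos : (0 : ℝ) < Fintype.card F := by exact_mod_cast Fintype.card_pos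

/-- Dividing out the `m`-th power part permutes the local types. -/
theorem partDensity_eq {g : F[X]} (hg : g.Monic) {n : ℕ} (hn : m * g.natDegree ≤ n)
    {c : F → Fˣ} (hc : ∀ a, (g ^ m).eval a = c a) (τ : F → Fin m × Fˣ) :
    partDensity g τ n = ((Fintype.card F : ℝ)⁻¹ ^ m) ^ g.natDegree *
      typeDensity (divType τ c) (n - m * g.natDegree) := by
  have himg : {f : F[X] | f.degree = n ∧ HasType f τ ∧ ∃ h, PowerFree m h ∧ f = g ^ m * h} =
      (fun h => g ^ m * h) '' {h : F[X] | h.degree = (n - m * g.natDegree : ℕ) ∧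
        HasType h (divType τ c) ∧ PowerFree m h} := by
    ext f
    simp only [Set.mem_ofPred_eq, Set.mem_image]
    constructor
    · rintro ⟨hd, ht, h, hh, rfl⟩
      exact ⟨h, ⟨(degree_pow_mul_eq_iff hg.ne_zero hn).1 hd, (hasType_mul_iff hc).1 ht, hh⟩, rfl⟩
    · rintro ⟨h, ⟨hd, ht, hh⟩, rfl⟩
      exact ⟨(degree_pow_mul_eq_iff hg.ne_zero hn).2 hd, (hasType_mul_iff hc).2 ht, h, hh, rfl⟩
  have hq := (cardF_pos (F := F)).ne'
  rw [partDensity, himg, Set.ncard_image_of_injective _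
    fun _ _ h => mul_left_cancel₀ (pow_ne_zero _ hg.ne_zero) h, typeDensity, ← pow_mul, inv_pow]
  have hpow : (Fintype.card F : ℝ) ^ n = (Fintype.card F : ℝ) ^ (m * g.natDegree) *
      (Fintype.card F : ℝ) ^ (n - m * g.natDegree) := by
    rw [← pow_add]; congr 1; omega
  rw [hpow]
  rw [show typeDegree (divType τ c) = typeDegree τ from rfl]
  field_simp

/-- A polynomial whose `m`-th power part vanishes at `a` has no local type at `a`. -/
theorem partDensity_eq_zero {g : F[X]} {a : F} (ha : g.eval a = 0) (τ : F → Fin m × Fˣ) (n : ℕ) :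
    partDensity g τ n = 0 := by
  have : {f : F[X] | f.degree = n ∧ HasType f τ ∧ ∃ h, PowerFree m h ∧ f = g ^ m * h} = ∅ := by
    rw [Set.eq_empty_iff_forall_notMem]
    rintro f ⟨hd, ht, h, -, rfl⟩
    have h0 : g ^ m * h ≠ 0 := by intro h0; simp [h0] at hd
    have hdvd : (X - C a) ^ m ∣ g ^ m * h :=
      (pow_dvd_pow_of_dvd (dvd_iff_isRoot.2 ha) m).mul_right h
    have := (le_rootMultiplicity_iff h0).2 hdvd
    rw [ht.rootMultiplicity_eq] at this
    exact (τ a).1.2.not_ge this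
  rw [partDensity, this]
  simp

theorem typeDensity_eq_partDensity_one (τ : F → Fin m × Fˣ) (n : ℕ) :
    typeDensity τ n = partDensity 1 τ n := by
  simp only [typeDensity, partDensity, one_pow, one_mul, exists_eq_right']

/-- Sorting polynomials by their `m`-th power part. -/
theorem ncard_eq_sum_powerPart (hm : m ≠ 0) (P : F[X] → Prop) (n : ℕ) :
    {f : F[X] | f.degree = n ∧ P f}.ncard = ∑ g ∈ monicUpTo F m n hm,
      {f : F[X] | f.degree = n ∧ P f ∧ ∃ h, PowerFree m h ∧ f = g ^ m * h}.ncard := by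
  classical
  have hfin : ∀ Q : F[X] → Prop, {f : F[X] | f.degree = n ∧ Q f}.Finite := fun Q =>
    (finite_degree_eq n).subset fun f hf => hf.1
  have hpart : ∀ f : F[X], ∃ g : F[X], f ≠ 0 → g.Monic ∧ ∃ h, PowerFree m h ∧ f = g ^ m * h := by
    intro f
    by_cases hf : f = 0
    · exact ⟨0, fun h => absurd hf h⟩
    · obtain ⟨g, h, hg, hh, e⟩ := exists_powerFree_part hm hf
      exact ⟨g, fun _ => ⟨hg, h, hh, e⟩⟩
  choose part hpart using hpart
  have hne : ∀ f : F[X], f.degree = n → f ≠ 0 := by rintro f hf rfl; simp at hf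
  rw [Set.ncard_eq_toFinset_card _ (hfin P), Finset.card_eq_sum_card_fiberwise (f := part)
    (t := monicUpTo F m n hm)]
  · refine Finset.sum_congr rfl fun g hg => ?_
    rw [← Set.ncard_coe_finset]
    congr 1
    ext f
    rw [mem_monicUpTo] at hg
    simp only [Finset.coe_filter, Set.Finite.mem_toFinset, Set.mem_ofPred_eq]
    constructor
    · rintro ⟨⟨hd, hP⟩, rfl⟩
      exact ⟨hd, hP, (hpart f (hne f hd)).2⟩
    · rintro ⟨hd, hP, h, hh, e⟩
      obtain ⟨hpm, h', hh', e'⟩ := hpart f (hne f hd)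
      exact ⟨⟨hd, hP⟩, powerFree_part_unique hpm hg.1 hh' hh (e'.symm.trans e)⟩
  · intro f hf
    rw [Finset.mem_coe, Set.Finite.mem_toFinset] at hf
    obtain ⟨hpm, h, hh, e⟩ := hpart f (hne f hf.1)
    rw [Finset.mem_coe, mem_monicUpTo]
    refine ⟨hpm, ?_⟩
    have := natDegree_eq_of_degree_eq_some hf.1
    rw [e, natDegree_mul (pow_ne_zero _ hpm.ne_zero) hh.ne_zero, natDegree_pow] at this
    omega

theorem sum_partDensity (hm : m ≠ 0) (τ : F → Fin m × Fˣ) {n : ℕ} (hn : typeDegree τ ≤ n) :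
    ∑ g ∈ monicUpTo F m n hm, partDensity g τ n = Fintype.card F - 1 := by
  have hq := (cardF_pos (F := F)).ne'
  have h1 := ncard_hasType τ hn
  rw [ncard_eq_sum_powerPart hm] at h1
  simp only [partDensity]
  rw [← Finset.sum_div, ← Finset.mul_sum, div_eq_iff (pow_ne_zero _ hq), ← h1, mul_comm]
  push_cast
  rfl

/-- Coprimality excludes the case of two elements and `m = 2`, where the bound fails. -/
theorem three_le_card_pow (hm : 2 ≤ m) (hqm : Nat.Coprime (Fintype.card F) m) :
    3 ≤ Fintype.card F ^ (m - 1) := by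
  have hq : 1 < Fintype.card F := Fintype.one_lt_card
  rcases (show Fintype.card F = 2 ∨ 3 ≤ Fintype.card F by omega) with h | h
  · rw [h] at hqm ⊢
    have : m ≠ 2 := by rintro rfl; revert hqm; decide
    calc 3 ≤ 2 ^ 2 := by norm_num
      _ ≤ 2 ^ (m - 1) := Nat.pow_le_pow_right (by norm_num) (by omega)
  · exact h.trans (Nat.le_self_pow (by omega) _)

theorem card_mul_inv_pow_le (hm : 2 ≤ m) (hqm : Nat.Coprime (Fintype.card F) m) :
    (Fintype.card F : ℝ) * (Fintype.card F : ℝ)⁻¹ ^ m ≤ 1 / 3 := by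
  have hq := cardF_pos (F := F)
  have h3 : (3 : ℝ) ≤ (Fintype.card F : ℝ) ^ (m - 1) := by
    exact_mod_cast three_le_card_pow hm hqm
  obtain ⟨k, rfl⟩ : ∃ k, m = k + 1 := ⟨m - 1, by omega⟩
  rw [Nat.add_sub_cancel] at h3
  rw [pow_succ', ← mul_assoc, mul_inv_cancel₀ hq.ne', one_mul, inv_pow, one_div]
  exact inv_anti₀ (by norm_num) h3

theorem typeDegree_le (τ : F → Fin m × Fˣ) : typeDegree τ ≤ Fintype.card F * m := by
  refine (Finset.sum_le_card_nsmul _ _ m fun a _ => (τ a).1.2).trans ?_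
  simp

theorem typeDensity_nonneg (τ : F → Fin m × Fˣ) (n : ℕ) : 0 ≤ typeDensity τ n := by
  unfold typeDensity; positivity

theorem typeDensity_le (τ : F → Fin m × Fˣ) (n : ℕ) :
    typeDensity τ n ≤ (Fintype.card F : ℝ) ^ (Fintype.card F * m + 1) := by
  have hq := cardF_pos (F := F)
  have hq1 : (1 : ℝ) ≤ Fintype.card F := by exact_mod_cast Fintype.card_pos
  rw [typeDensity, div_le_iff₀ (pow_pos hq n), pow_succ, mul_assoc]
  refine mul_le_mul (pow_le_pow_right₀ hq1 (typeDegree_le τ)) ?_ (by positivity) (by positivity)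
  calc _ ≤ ({f : F[X] | f.degree = n}.ncard : ℝ) := by
        exact_mod_cast Set.ncard_le_ncard (fun f (hf : _ ∧ _) => hf.1) (finite_degree_eq n)
    _ ≤ _ := by
        rw [ncard_degree_eq]
        gcongr
        linarith

/-- The densities of the local types approach each other exponentially fast. Since the densities
of all polynomials of given local types agree, sorting by `m`-th power part expresses the
difference in degree `n` as a combination of the differences in the degrees `n - m j` with total
weight less than one. -/
theorem exists_typeDensity_sub_le (hm : 2 ≤ m) (hqm : Nat.Coprime (Fintype.card F) m) :
    ∃ K x : ℝ, 0 < x ∧ x < 1 ∧ ∀ (n : ℕ) (τ τ' : F → Fin m × Fˣ),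
      |typeDensity τ n - typeDensity τ' n| ≤ K * x ^ n := by
  classical
  set q : ℝ := (Fintype.card F : ℝ) with hqdef
  have hq : 0 < q := cardF_pos
  have hm0 : m ≠ 0 := by omega
  have hmR : (2 : ℝ) ≤ m := by exact_mod_cast hm
  -- any `x < 1` with `x ^ m ≥ 2 / 3` will do
  set x : ℝ := 1 - 1 / (3 * m) with hx
  have hx1 : x < 1 := by rw [hx]; linarith [show (0 : ℝ) < 1 / (3 * m) by positivity]
  have hx6 : 1 / (3 * (m : ℝ)) ≤ 1 / 6 :=
    one_div_le_one_div_of_le (by norm_num) (by linarith)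
  have hx0 : 0 < x := by rw [hx]; linarith
  have hxm : 2 / 3 ≤ x ^ m := by
    have := one_add_mul_le_pow (a := -(1 / (3 * (m : ℝ)))) (by linarith) m
    rw [hx, sub_eq_add_neg]
    refine le_trans (le_of_eq ?_) this
    field_simp
    norm_num
  set n₀ := Fintype.card F * m
  set K := q ^ (n₀ + 1) / x ^ n₀ with hK
  have hK0 : 0 ≤ K := by positivity
  refine ⟨K, x, hx0, hx1, fun n => ?_⟩
  induction n using Nat.strong_induction_on with
  | _ n IH =>
    intro τ τ'
    rcases lt_or_ge n n₀ with hn | hn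
    · calc |typeDensity τ n - typeDensity τ' n| ≤ q ^ (n₀ + 1) :=
            abs_sub_le_of_nonneg_of_le (typeDensity_nonneg _ _) (typeDensity_le _ _)
              (typeDensity_nonneg _ _) (typeDensity_le _ _)
        _ = K * x ^ n₀ := by rw [hK, div_mul_cancel₀ _ (pow_pos hx0 _).ne']
        _ ≤ K * x ^ n := mul_le_mul_of_nonneg_left
            (pow_le_pow_of_le_one hx0.le hx1.le hn.le) hK0
    · have h1 : (1 : F[X]) ∈ monicUpTo F m n hm0 := by simp [mem_monicUpTo]
      have e := sum_partDensity hm0 τ ((typeDegree_le τ).trans hn)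
      have e' := sum_partDensity hm0 τ' ((typeDegree_le τ').trans hn)
      rw [← Finset.add_sum_erase _ _ h1, ← typeDensity_eq_partDensity_one] at e e'
      have hdiff : typeDensity τ n - typeDensity τ' n =
          ∑ g ∈ (monicUpTo F m n hm0).erase 1, (partDensity g τ' n - partDensity g τ n) := by
        rw [Finset.sum_sub_distrib]; linarith
      rw [hdiff]
      set w := q⁻¹ ^ m / x ^ m with hw
      have hqw : (Fintype.card F : ℝ) * w ≤ 1 / 2 := by
        rw [hw, ← mul_div_assoc, div_le_iff₀ (by positivity)]
        have := card_mul_inv_pow_le (F := F) hm hqm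
        linarith
      calc _ ≤ ∑ g ∈ (monicUpTo F m n hm0).erase 1, |partDensity g τ' n - partDensity g τ n| :=
            Finset.abs_sum_le_sum_abs _ _
        _ ≤ ∑ g ∈ (monicUpTo F m n hm0).erase 1, K * x ^ n * w ^ g.natDegree := by
            refine Finset.sum_le_sum fun g hg => ?_
            rw [Finset.mem_erase, mem_monicUpTo] at hg
            obtain ⟨hg1, hgm, hgn⟩ := hg
            by_cases hroot : ∃ a, g.eval a = 0
            · obtain ⟨a, ha⟩ := hroot
              rw [partDensity_eq_zero ha, partDensity_eq_zero ha, sub_zero, abs_zero]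
              positivity
            push Not at hroot
            set c : F → Fˣ := fun a => Units.mk0 ((g ^ m).eval a)
              (by rw [eval_pow]; exact pow_ne_zero _ (hroot a))
            have hc : ∀ a, (g ^ m).eval a = c a := fun a => rfl
            have hlt : n - m * g.natDegree < n := by
              have h0 : g.natDegree ≠ 0 := fun h => hg1 (hgm.natDegree_eq_zero.1 h)
              have : 0 < m * g.natDegree :=
                Nat.mul_pos (Nat.pos_of_ne_zero hm0) (Nat.pos_of_ne_zero h0)
              omega
            rw [partDensity_eq hgm hgn hc, partDensity_eq hgm hgn hc, ← mul_sub, abs_mul,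
              abs_of_nonneg (by positivity)]
            refine (mul_le_mul_of_nonneg_left (IH _ hlt _ _) (by positivity)).trans (le_of_eq ?_)
            have hxn : x ^ n = (x ^ m) ^ g.natDegree * x ^ (n - m * g.natDegree) := by
              rw [← pow_mul, ← pow_add]; congr 1; omega
            rw [hw, div_pow, hxn, ← hqdef]
            field_simp
        _ = K * x ^ n * ∑ g ∈ (monicUpTo F m n hm0).erase 1, w ^ g.natDegree := by
            rw [Finset.mul_sum]
        _ ≤ K * x ^ n * 1 := by
            refine mul_le_mul_of_nonneg_left ?_ (by positivity)
            refine (sum_monicUpTo_le hm0 (by positivity) hqw (by norm_num)).trans (by norm_num)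
        _ = K * x ^ n := mul_one _

/-- At least half of the polynomials of degree `n` are `m`-th power-free. -/
theorem le_ncard_powerFree (hm : 2 ≤ m) (hqm : Nat.Coprime (Fintype.card F) m) (n : ℕ) :
    (Fintype.card F : ℝ) ^ n / 2 ≤ {f : F[X] | f.degree = n ∧ PowerFree m f}.ncard := by
  classical
  set q : ℝ := (Fintype.card F : ℝ) with hqdef
  have hq : 0 < q := cardF_pos
  have hq2 : 2 ≤ q := by rw [hqdef]; exact_mod_cast Fintype.one_lt_card
  have hm0 : m ≠ 0 := by omega
  have h1 : (1 : F[X]) ∈ monicUpTo F m n hm0 := by simp [mem_monicUpTo]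
  have e := ncard_eq_sum_powerPart (F := F) hm0 (fun _ => True) n
  simp only [true_and, and_true] at e
  rw [← Finset.add_sum_erase _ _ h1] at e
  have e1 : {f : F[X] | f.degree = n ∧ ∃ h, PowerFree m h ∧ f = 1 ^ m * h} =
      {f : F[X] | f.degree = n ∧ PowerFree m f} := by
    simp only [one_pow, one_mul, exists_eq_right']
  rw [e1] at e
  have e2 : (q - 1) * q ^ n = ({f : F[X] | f.degree = n ∧ PowerFree m f}.ncard : ℝ) +
      ∑ g ∈ (monicUpTo F m n hm0).erase 1,
        ({f : F[X] | f.degree = n ∧ ∃ h, PowerFree m h ∧ f = g ^ m * h}.ncard : ℝ) := by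
    rw [hqdef, ← ncard_degree_eq]
    exact_mod_cast e
  have hle : ∀ g ∈ (monicUpTo F m n hm0).erase 1,
      ({f : F[X] | f.degree = n ∧ ∃ h, PowerFree m h ∧ f = g ^ m * h}.ncard : ℝ) ≤
        (q - 1) * q ^ n * (q⁻¹ ^ m) ^ g.natDegree := by
    intro g hg
    rw [Finset.mem_erase, mem_monicUpTo] at hg
    obtain ⟨hg1, hgm, hgn⟩ := hg
    have hsub : {f : F[X] | f.degree = n ∧ ∃ h, PowerFree m h ∧ f = g ^ m * h} ⊆
        (fun h => g ^ m * h) '' {h : F[X] | h.degree = (n - m * g.natDegree : ℕ)} := by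
      rintro f ⟨hd, h, -, rfl⟩
      exact ⟨h, (degree_pow_mul_eq_iff hgm.ne_zero hgn).1 hd, rfl⟩
    have := (Set.ncard_le_ncard hsub ((finite_degree_eq _).image _)).trans
      (Set.ncard_image_le (finite_degree_eq _))
    calc _ ≤ ({h : F[X] | h.degree = (n - m * g.natDegree : ℕ)}.ncard : ℝ) := by
          exact_mod_cast this
      _ = (q - 1) * q ^ (n - m * g.natDegree) := ncard_degree_eq _
      _ = _ := by
        have hpow : q ^ n = q ^ (m * g.natDegree) * q ^ (n - m * g.natDegree) := by
          rw [← pow_add]; congr 1; omega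
        rw [hpow, ← pow_mul, inv_pow]
        field_simp
  have hsum := Finset.sum_le_sum hle
  rw [← Finset.mul_sum] at hsum
  have hhalf := sum_monicUpTo_le (F := F) (n := n) hm0 (w := q⁻¹ ^ m) (by positivity)
    (card_mul_inv_pow_le hm hqm) (by norm_num)
  replace hhalf := hhalf.trans (show _ ≤ (1 / 2 : ℝ) by norm_num)
  have hqn : 1 * q ^ n ≤ (q - 1) * q ^ n := by gcongr; linarith
  have := mul_le_mul_of_nonneg_left hhalf (show 0 ≤ (q - 1) * q ^ n by
    refine mul_nonneg (by linarith) (by positivity))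
  linarith

end Equidistribution

/-! ### The law of the number of points above one point of the line -/

section LocalLaw

variable {F : Type*} [Field F] {m : ℕ}

/-- The number of rational points of the normalization above a point where `f` has order of
vanishing `s` and leading coefficient `v`, `p = (s, v)`. -/
noncomputable def localPoints (p : Fin m × Fˣ) : ℕ :=
  Nat.card {z : F // z ^ Nat.gcd m p.1 = p.2}

variable [Fintype F]

theorem localPoints_eq (p : Fin m × Fˣ) : (p.2 ∈ (powMonoidHom (Nat.gcd m p.1) : Fˣ →* Fˣ).range →
    localPoints p = tgcd (Fintype.card F) m p.1) ∧
    (p.2 ∉ (powMonoidHom (Nat.gcd m p.1) : Fˣ →* Fˣ).range → localPoints p = 0) := by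
  classical
  set e := Nat.gcd m p.1 with he
  have he0 : e ≠ 0 := by
    have : 0 < m := p.1.pos
    rw [he]
    exact (Nat.gcd_pos_of_pos_left _ this).ne'
  constructor
  · rintro ⟨u, hu⟩
    rw [powMonoidHom_apply] at hu
    have hcard := IsCyclic.card_powMonoidHom_ker (G := Fˣ) e
    rw [Nat.card_eq_fintype_card (α := Fˣ), Fintype.card_units, Nat.gcd_comm] at hcard
    rw [tgcd, ← hcard, localPoints]
    have hu' : (u : F) ^ e = p.2 := by rw [← hu]; simp
    refine Nat.card_congr
      { toFun := fun z => ⟨Units.mk0 (z.1 / u) (div_ne_zero ?_ u.ne_zero), ?_⟩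
        invFun := fun k => ⟨(k : Fˣ) * u, ?_⟩
        left_inv := fun z => ?_
        right_inv := fun k => ?_ }
    · intro h0
      have := z.2
      rw [h0, zero_pow he0] at this
      exact p.2.ne_zero this.symm
    · rw [MonoidHom.mem_ker, powMonoidHom_apply]
      ext
      have := z.2
      simp only [Units.val_pow_eq_pow_val, Units.val_mk0, Units.val_one, div_pow]
      rw [this, hu', div_self p.2.ne_zero]
    · have := k.2
      rw [MonoidHom.mem_ker, powMonoidHom_apply] at this
      have h1 : ((k : Fˣ) : F) ^ e = 1 := by rw [← Units.val_pow_eq_pow_val, this, Units.val_one]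
      rw [mul_pow, h1, one_mul, hu']
    · ext; simp
    · ext; simp
  · intro h
    rw [localPoints, Nat.card_eq_zero]
    refine Or.inl ⟨fun z => h ?_⟩
    have hz : z.1 ≠ 0 := by
      intro h0
      have := z.2
      rw [h0, zero_pow he0] at this
      exact p.2.ne_zero this.symm
    exact ⟨Units.mk0 z.1 hz, by ext; simpa using z.2⟩

/-- The weight of a local type at one point: the density of the residue class it defines. -/
noncomputable def localWeight (p : Fin m × Fˣ) : ℝ := (Fintype.card F : ℝ)⁻¹ ^ (p.1 + 1 : ℕ)

theorem card_range_mul_tgcd (m s : ℕ) :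
    (Nat.card (powMonoidHom (Nat.gcd m s) : Fˣ →* Fˣ).range : ℝ) * tgcd (Fintype.card F) m s =
      Fintype.card F - 1 := by
  classical
  have h := IsCyclic.card_powMonoidHom_range (G := Fˣ) (Nat.gcd m s)
  rw [Nat.card_eq_fintype_card (α := Fˣ), Fintype.card_units, Nat.gcd_comm (Fintype.card F - 1)] at h
  have h' : Nat.card (powMonoidHom (Nat.gcd m s) : Fˣ →* Fˣ).range * tgcd (Fintype.card F) m s =
      Fintype.card F - 1 := by
    rw [h]
    exact Nat.div_mul_cancel (Nat.gcd_dvd_right _ _)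
  have : ((Fintype.card F - 1 : ℕ) : ℝ) = Fintype.card F - 1 := by
    rw [Nat.cast_sub Fintype.card_pos, Nat.cast_one]
  rw [← this, ← h']
  push_cast
  rfl

open Classical in
theorem card_localPoints_eq (s : Fin m) (N : ℕ) :
    ((Finset.univ.filter fun v : Fˣ => localPoints (s, v) = N).card : ℝ) =
      if N = 0 then (Fintype.card F - 1) * (1 - 1 / (tgcd (Fintype.card F) m s : ℝ))
      else if tgcd (Fintype.card F) m s = N then (Fintype.card F - 1) / (N : ℝ) else 0 := by
  set R := (powMonoidHom (Nat.gcd m s) : Fˣ →* Fˣ).range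
  set G := tgcd (Fintype.card F) m s
  have hG : 0 < G := tgcd_pos Fintype.one_lt_card m s
  have hGR : (G : ℝ) ≠ 0 := by exact_mod_cast hG.ne'
  have hR : (Nat.card R : ℝ) = (Fintype.card F - 1) / G := by
    rw [eq_div_iff hGR]; exact card_range_mul_tgcd m s
  have hRc : (Finset.univ.filter fun v : Fˣ => v ∈ R).card = Nat.card R := by
    rw [Nat.card_eq_fintype_card, Fintype.card_subtype]
  have hl : ∀ v : Fˣ, localPoints (s, v) = if v ∈ R then G else 0 := by
    intro v
    split_ifs with h
    · exact (localPoints_eq (s, v)).1 h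
    · exact (localPoints_eq (s, v)).2 h
  split_ifs with hN hN'
  · have : (Finset.univ.filter fun v : Fˣ => localPoints (s, v) = N) =
        Finset.univ.filter fun v : Fˣ => ¬ v ∈ R := by
      ext v
      by_cases h : v ∈ R <;> simp [hl, h, hN, hG.ne']
    have hsum := Finset.card_filter_add_card_filter_not (s := (Finset.univ : Finset Fˣ))
      (fun v => v ∈ R)
    rw [Finset.card_univ, Fintype.card_units, hRc] at hsum
    have h1 : ((Fintype.card F - 1 : ℕ) : ℝ) = Fintype.card F - 1 := by
      rw [Nat.cast_sub Fintype.card_pos, Nat.cast_one]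
    rw [this]
    have h2 : (Nat.card R : ℝ) + ((Finset.univ.filter fun v : Fˣ => ¬ v ∈ R).card : ℝ) =
        Fintype.card F - 1 := by rw [← h1]; exact_mod_cast hsum
    rw [hR] at h2
    rw [← eq_sub_iff_add_eq'] at h2
    rw [h2]
    ring
  · have : (Finset.univ.filter fun v : Fˣ => localPoints (s, v) = N) =
        Finset.univ.filter fun v : Fˣ => v ∈ R := by
      ext v
      by_cases h : v ∈ R <;> simp [hl, h, hN', Ne.symm hN]
    rw [this, hRc, hR, hN']
  · have : (Finset.univ.filter fun v : Fˣ => localPoints (s, v) = N) = ∅ := by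
      ext v
      by_cases h : v ∈ R <;> simp [hl, h, hN', Ne.symm hN]
    simp [this]

open Classical in
/-- Up to normalization, `pointProb` is the law of the number of points of a random local type. -/
theorem sum_localWeight_localPoints (hm : 0 < m) (N : ℕ) :
    ∑ p : Fin m × Fˣ with localPoints p = N, localWeight p =
      (1 - (Fintype.card F : ℝ)⁻¹ ^ m) * pointProb (Fintype.card F) m N := by
  set q : ℝ := (Fintype.card F : ℝ) with hq
  have hq0 : q ≠ 0 := (cardF_pos (F := F)).ne'
  have hZ : 1 - q⁻¹ ^ m ≠ 0 :=
    (sub_pos.2 (pow_lt_one₀ (by positivity) (inv_lt_one Fintype.one_lt_card) hm.ne')).ne'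
  have h1 : ∑ p : Fin m × Fˣ with localPoints p = N, localWeight p =
      ∑ s : Fin m, q⁻¹ ^ (s + 1 : ℕ) *
        ((Finset.univ.filter fun v : Fˣ => localPoints (s, v) = N).card : ℝ) := by
    rw [Finset.sum_filter, Fintype.sum_prod_type]
    refine Finset.sum_congr rfl fun s _ => ?_
    rw [← Finset.sum_filter, Finset.sum_congr rfl fun v _ => show localWeight (s, v) =
      q⁻¹ ^ (s + 1 : ℕ) from rfl, Finset.sum_const, nsmul_eq_mul, mul_comm]
  rw [h1]
  simp_rw [card_localPoints_eq]
  rw [Fin.sum_univ_eq_sum_range (fun s => q⁻¹ ^ (s + 1) *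
    if N = 0 then (q - 1) * (1 - 1 / (tgcd (Fintype.card F) m s : ℝ))
      else if tgcd (Fintype.card F) m s = N then (q - 1) / (N : ℝ) else 0), pointProb, ← hq]
  generalize 1 - q⁻¹ ^ m = Z at hZ ⊢
  split_ifs with hN
  · rw [Finset.mul_sum]
    refine Finset.sum_congr rfl fun s _ => ?_
    have hG : (tgcd (Fintype.card F) m s : ℝ) ≠ 0 := by
      exact_mod_cast (tgcd_pos Fintype.one_lt_card m s).ne'
    rw [pow_succ]
    field_simp
  · rw [Finset.mul_sum, Finset.sum_filter]
    refine Finset.sum_congr rfl fun s _ => ?_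
    have hNR : (N : ℝ) ≠ 0 := by exact_mod_cast hN
    split_ifs with h
    · rw [pow_succ]
      field_simp
    · simp

open Classical in
theorem sum_localWeight (hm : 0 < m) :
    ∑ p : Fin m × Fˣ, localWeight p = 1 - (Fintype.card F : ℝ)⁻¹ ^ m := by
  have hq := Fintype.one_lt_card (α := F)
  have hmaps : ∀ p ∈ (Finset.univ : Finset (Fin m × Fˣ)),
      localPoints p ∈ Finset.range (Fintype.card F) := by
    intro p _
    rw [Finset.mem_range]
    by_cases h : p.2 ∈ (powMonoidHom (Nat.gcd m p.1) : Fˣ →* Fˣ).range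
    · rw [(localPoints_eq p).1 h]
      exact tgcd_lt hq m _
    · rw [(localPoints_eq p).2 h]
      omega
  rw [← Finset.sum_fiberwise_of_maps_to hmaps]
  simp_rw [sum_localWeight_localPoints hm]
  rw [← Finset.mul_sum, pointProb_sum hq hm, mul_one]

end LocalLaw

section RandomSum

theorem measureReal_eq_pointProb {Ω : Type*} [MeasurableSpace Ω] {μ : Measure Ω} {q m : ℕ}
    (hq : 1 < q) (hm : 0 < m) {Y : Ω → ℕ} (hY : HasLaw Y (pointLaw q m hq hm).toMeasure μ)
    (N : ℕ) : μ.real (Y ⁻¹' {N}) = pointProb q m N := by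
  have := hY.measureReal_eq (p := fun x => x = N) (measurableSet_singleton N)
  refine this.trans ?_
  rw [Measure.real, show {x | x = N} = {N} from rfl,
    PMF.toMeasure_apply_singleton _ _ (measurableSet_singleton N)]
  exact ENNReal.toReal_ofReal (pointProb_nonneg hq N)

open Classical in
/-- The law of the sum of the limiting random variables, as a weighted count of local types. -/
theorem measureReal_sum_eq {F : Type*} [Field F] [Fintype F] {m : ℕ} (hm : 0 < m)
    {Ω : Type*} [MeasurableSpace Ω] {μ : Measure Ω} [IsProbabilityMeasure μ]
    {Y : Fin (Fintype.card F) → Ω → ℕ} (hind : iIndepFun Y μ)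
    (hY : ∀ j, HasLaw (Y j) (pointLaw (Fintype.card F) m Fintype.one_lt_card hm).toMeasure μ)
    (k : ℕ) :
    μ.real {ω | ∑ j, Y j ω = k} =
      (∑ τ : F → Fin m × Fˣ with ∑ a, localPoints (τ a) = k, ∏ a, localWeight (τ a)) /
        ∑ τ : F → Fin m × Fˣ, ∏ a, localWeight (τ a) := by
  have hq : 1 < Fintype.card F := Fintype.one_lt_card
  set Z : ℝ := 1 - (Fintype.card F : ℝ)⁻¹ ^ m with hZdef
  have hZ : Z ≠ 0 :=
    (sub_pos.2 (pow_lt_one₀ (by positivity) (inv_lt_one hq) hm.ne')).ne'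
  have hden : ∑ τ : F → Fin m × Fˣ, ∏ a, localWeight (τ a) = Z ^ Fintype.card F := by
    rw [← Fintype.prod_sum fun (_ : F) (p : Fin m × Fˣ) => localWeight p]
    simp [sum_localWeight hm, hZdef]
  have hnum : ∑ τ : F → Fin m × Fˣ with ∑ a, localPoints (τ a) = k, ∏ a, localWeight (τ a) =
      Z ^ Fintype.card F * ∑ N ∈ Finset.piAntidiag (Finset.univ : Finset F) k, ∏ a, pointProb (Fintype.card F) m (N a) := by
    have hmaps : ∀ τ ∈ (Finset.univ.filter fun τ : F → Fin m × Fˣ => ∑ a, localPoints (τ a) = k),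
        (fun a => localPoints (τ a)) ∈ Finset.piAntidiag (Finset.univ : Finset F) k := by
      intro τ hτ
      simpa using hτ
    rw [← Finset.sum_fiberwise_of_maps_to hmaps, Finset.mul_sum]
    refine Finset.sum_congr rfl fun N hN => ?_
    have hset : ((Finset.univ.filter fun τ : F → Fin m × Fˣ => ∑ a, localPoints (τ a) = k).filter
        fun τ => (fun a => localPoints (τ a)) = N) =
        Fintype.piFinset fun a => Finset.univ.filter fun p : Fin m × Fˣ =>
          localPoints p = N a := by
      ext τ
      simp only [Finset.mem_piAntidiag, Finset.mem_univ, implies_true, and_true] at hN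
      simp only [Finset.mem_filter, Finset.mem_univ, true_and, Fintype.mem_piFinset, funext_iff]
      refine ⟨fun h => h.2, fun h => ⟨?_, h⟩⟩
      rw [← hN]
      exact Finset.sum_congr rfl fun a _ => h a
    rw [hset, ← Finset.prod_univ_sum]
    simp_rw [sum_localWeight_localPoints hm]
    rw [Finset.prod_mul_distrib, Finset.prod_const, Finset.card_univ]
  rw [hnum, hden, mul_div_cancel_left₀ _ (pow_ne_zero _ hZ)]
  have hset : {ω | ∑ j, Y j ω = k} = ⋃ N ∈ Finset.piAntidiag (Finset.univ : Finset (Fin (Fintype.card F))) k,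
      ⋂ j ∈ (Finset.univ : Finset (Fin (Fintype.card F))), Y j ⁻¹' {N j} := by
    ext ω
    simp only [Set.mem_ofPred_eq, Set.mem_iUnion, Set.mem_iInter, Finset.mem_univ, true_imp_iff,
      Set.mem_preimage, Set.mem_singleton_iff, Finset.mem_piAntidiag, implies_true, and_true,
      exists_prop]
    constructor
    · intro h
      exact ⟨fun j => Y j ω, h, fun j => rfl⟩
    · rintro ⟨N, hN, h⟩
      rw [← hN]
      exact Finset.sum_congr rfl fun j _ => h j
  have hmeas : ∀ N : Fin (Fintype.card F) → ℕ,
      NullMeasurableSet (⋂ j ∈ (Finset.univ : Finset (Fin (Fintype.card F))), Y j ⁻¹' {N j}) μ := fun N =>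
    NullMeasurableSet.biInter (Finset.countable_toSet _) fun j _ =>
      (hY j).aemeasurable.nullMeasurableSet_preimage (measurableSet_singleton _)
  rw [hset, measureReal_biUnion_finset₀ ?_ fun N _ => hmeas N]
  · set e : Fin (Fintype.card F) ≃ F := (Fintype.equivFin F).symm
    refine Finset.sum_bij' (fun N _ a => N (e.symm a)) (fun N _ j => N (e j)) ?_ ?_ ?_ ?_ ?_
    · intro N hN
      simp only [Finset.mem_piAntidiag, Finset.mem_univ, implies_true, and_true] at hN ⊢
      rw [← hN]
      exact Equiv.sum_comp e.symm N
    · intro N hN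
      simp only [Finset.mem_piAntidiag, Finset.mem_univ, implies_true, and_true] at hN ⊢
      rw [← hN]
      exact Equiv.sum_comp e N
    · intro N _; simp
    · intro N _; simp
    · intro N _
      rw [Measure.real, hind.measure_inter_preimage_eq_mul _ fun j _ => measurableSet_singleton _,
        ENNReal.toReal_prod, ← Equiv.prod_comp e]
      refine Finset.prod_congr rfl fun j _ => ?_
      simp only [Equiv.symm_apply_apply]
      exact measureReal_eq_pointProb hq hm (hY j) _
  · intro N _ N' _ hNN'
    refine Disjoint.aedisjoint (Set.disjoint_left.2 fun ω h h' => hNN' ?_)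
    simp only [Set.mem_iInter, Finset.mem_univ, true_imp_iff, Set.mem_preimage,
      Set.mem_singleton_iff] at h h'
    funext j
    rw [← h j, ← h' j]

end RandomSum

/-! ### Degenerate polynomials and the limit -/

section Limits

theorem tendsto_div_of_sub_mul {x y : ℕ → ℝ} {L c : ℝ} (hc : 0 < c)
    (h : Tendsto (fun n => x n - L * y n) atTop (𝓝 0)) (hy : ∀ᶠ n in atTop, c ≤ y n) :
    Tendsto (fun n => x n / y n) atTop (𝓝 L) := by
  rw [tendsto_iff_norm_sub_tendsto_zero]
  have h' : Tendsto (fun n => ‖x n - L * y n‖ / c) atTop (𝓝 0) := by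
    simpa using h.norm.div_const c
  refine squeeze_zero' (Eventually.of_forall fun n => norm_nonneg _) ?_ h'
  filter_upwards [hy] with n hn
  have hpos : 0 < y n := hc.trans_le hn
  have : x n / y n - L = (x n - L * y n) / y n := by field_simp
  rw [this, norm_div, Real.norm_of_nonneg hpos.le]
  exact div_le_div_of_nonneg_left (norm_nonneg _) hc hn

/-- If the functions `A i` become equal in the limit then the weighted sum of some of them is
asymptotic to the corresponding fraction of the whole weighted sum. -/
theorem tendsto_weighted_sum {ι : Type*} [Fintype ι] (T : Finset ι) {w : ι → ℝ}
    (hW : ∑ i, w i ≠ 0) {A : ι → ℕ → ℝ}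
    (hA : ∀ i j, Tendsto (fun n => A i n - A j n) atTop (𝓝 0)) :
    Tendsto (fun n => ∑ i ∈ T, w i * A i n -
      (∑ i ∈ T, w i) / (∑ i, w i) * ∑ i, w i * A i n) atTop (𝓝 0) := by
  have key : ∀ n, ∑ i ∈ T, w i * A i n - (∑ i ∈ T, w i) / (∑ i, w i) * ∑ i, w i * A i n =
      (∑ i, w i)⁻¹ * ∑ i ∈ T, ∑ j, w i * w j * (A i n - A j n) := by
    intro n
    have : ∑ i ∈ T, ∑ j, w i * w j * (A i n - A j n) =
        (∑ i ∈ T, w i * A i n) * ∑ j, w j - (∑ i ∈ T, w i) * ∑ j, w j * A j n := by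
      rw [Finset.sum_mul_sum, Finset.sum_mul_sum, ← Finset.sum_sub_distrib]
      refine Finset.sum_congr rfl fun i _ => ?_
      rw [← Finset.sum_sub_distrib]
      exact Finset.sum_congr rfl fun j _ => by ring
    rw [this]
    field_simp
  simp_rw [key]
  rw [show (0 : ℝ) = (∑ i, w i)⁻¹ * ∑ i ∈ T, ∑ j, w i * w j * 0 by simp]
  exact (tendsto_finsetSum _ fun i _ => tendsto_finsetSum _ fun j _ =>
    (hA i j).const_mul _).const_mul _

variable {F : Type*} [Field F] {m : ℕ}

/-- `f` is a constant multiple of a `p`-th power for some prime `p ∣ m`; for all other `f` the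
curve `C_f` is geometrically irreducible. -/
def IsDegenerate (m : ℕ) (f : F[X]) : Prop :=
  ∃ p : ℕ, p.Prime ∧ p ∣ m ∧ ∃ (c : F) (g : F[X]), f = C c * g ^ p

variable [Fintype F]

theorem ncard_isDegenerate_le (hm : m ≠ 0) (n : ℕ) :
    {f : F[X] | f.degree = n ∧ IsDegenerate m f}.ncard ≤
      (m + 1) * (Fintype.card F * Fintype.card F ^ (n / 2 + 1)) := by
  classical
  set S : Finset (ℕ × F × F[X]) := Finset.range (m + 1) ×ˢ (Finset.univ ×ˢ
    (finite_degree_lt (F := F) (n / 2 + 1)).toFinset)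
  have hsub : {f : F[X] | f.degree = n ∧ IsDegenerate m f} ⊆
      (S.image fun x => C x.2.1 * x.2.2 ^ x.1 : Finset F[X]) := by
    rintro f ⟨hd, p, hp, hpm, c, g, rfl⟩
    rw [Finset.mem_coe, Finset.mem_image]
    have h0 : C c * g ^ p ≠ 0 := by intro h0; rw [h0] at hd; simp at hd
    have hc : (C c : F[X]) ≠ 0 := left_ne_zero_of_mul h0
    have hg : g ≠ 0 := by
      rintro rfl
      exact h0 (by simp [hp.ne_zero])
    refine ⟨(p, c, g), ?_, rfl⟩
    simp only [S, Finset.mem_product, Finset.mem_range, Finset.mem_univ, true_and,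
      Set.Finite.mem_toFinset, Set.mem_ofPred_eq]
    refine ⟨Nat.lt_succ_of_le (Nat.le_of_dvd (Nat.pos_of_ne_zero hm) hpm), ?_⟩
    have hnd := natDegree_eq_of_degree_eq_some hd
    rw [natDegree_mul hc (pow_ne_zero _ hg), natDegree_C, natDegree_pow, zero_add] at hnd
    have h2 : 2 * g.natDegree ≤ n := hnd ▸ Nat.mul_le_mul_right _ hp.two_le
    rw [degree_eq_natDegree hg]
    exact_mod_cast (by omega : g.natDegree < n / 2 + 1)
  refine (Set.ncard_le_ncard hsub (Finset.finite_toSet _)).trans ?_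
  rw [Set.ncard_coe_finset]
  refine Finset.card_image_le.trans (le_of_eq ?_)
  rw [Finset.card_product, Finset.card_product, Finset.card_range, Finset.card_univ,
    ← Set.ncard_eq_toFinset_card _ (finite_degree_lt (F := F) (n / 2 + 1)), ncard_degree_lt]

theorem tendsto_ncard_isDegenerate (hm : m ≠ 0) :
    Tendsto (fun n : ℕ => ({f : F[X] | f.degree = n ∧ IsDegenerate m f}.ncard : ℝ) /
      (Fintype.card F : ℝ) ^ n) atTop (𝓝 0) := by
  set q : ℝ := (Fintype.card F : ℝ) with hq
  have hq0 : 0 < q := cardF_pos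
  have hq1 : 1 < q := by rw [hq]; exact_mod_cast Fintype.one_lt_card
  have hlim : Tendsto (fun n : ℕ => (m + 1) * (q * q) * q⁻¹ ^ (n - n / 2)) atTop (𝓝 0) := by
    rw [show (0 : ℝ) = (m + 1) * (q * q) * 0 by simp]
    refine Tendsto.const_mul _ ((tendsto_pow_atTop_nhds_zero_of_lt_one (by positivity)
      (inv_lt_one_of_one_lt₀ hq1)).comp ?_)
    exact tendsto_atTop.2 fun b => by
      filter_upwards [eventually_ge_atTop (2 * b)] with n hn
      omega
  refine squeeze_zero (fun n => by positivity) (fun n => ?_) hlim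
  rw [div_le_iff₀ (by positivity)]
  calc _ ≤ (m + 1) * (q * q ^ (n / 2 + 1)) := by
        have := ncard_isDegenerate_le (F := F) hm n
        rw [hq]; exact_mod_cast this
    _ = (m + 1) * (q * q) * q⁻¹ ^ (n - n / 2) * q ^ n := by
        have hpow : q ^ n = q ^ (n - n / 2) * q ^ (n / 2) := by
          rw [← pow_add]; congr 1; omega
        rw [hpow, inv_pow, pow_succ]
        field_simp

theorem abs_ncard_sub_le {n : ℕ} {P P' R : F[X] → Prop} (h : ∀ f, ¬ R f → (P f ↔ P' f)) :
    |({f : F[X] | f.degree = n ∧ P f}.ncard : ℝ) - {f : F[X] | f.degree = n ∧ P' f}.ncard| ≤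
      {f : F[X] | f.degree = n ∧ R f}.ncard := by
  have key : ∀ {P P' : F[X] → Prop}, (∀ f, ¬ R f → (P f ↔ P' f)) →
      ({f : F[X] | f.degree = n ∧ P f}.ncard : ℝ) ≤ {f : F[X] | f.degree = n ∧ P' f}.ncard +
        {f : F[X] | f.degree = n ∧ R f}.ncard := by
    intro P P' h
    have hfin : ∀ Q : F[X] → Prop, {f : F[X] | f.degree = n ∧ Q f}.Finite := fun Q =>
      (finite_degree_eq n).subset fun f hf => hf.1
    have hsub : {f : F[X] | f.degree = n ∧ P f} ⊆
        {f : F[X] | f.degree = n ∧ P' f} ∪ {f : F[X] | f.degree = n ∧ R f} := by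
      rintro f ⟨hd, hP⟩
      by_cases hR : R f
      · exact Or.inr ⟨hd, hR⟩
      · exact Or.inl ⟨hd, (h f hR).1 hP⟩
    exact_mod_cast (Set.ncard_le_ncard hsub ((hfin _).union (hfin _))).trans
      (Set.ncard_union_le _ _)
  rw [abs_le]
  constructor
  · linarith [key fun f hf => (h f hf).symm]
  · linarith [key h]

theorem prod_localWeight (τ : F → Fin m × Fˣ) :
    ∏ a, localWeight (τ a) = ((Fintype.card F : ℝ) ^ typeDegree τ)⁻¹ := by
  simp only [localWeight, typeDegree]
  rw [Finset.prod_pow_eq_pow_sum, inv_pow]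

open Classical in
theorem ncard_powerFree_type (P : (F → Fin m × Fˣ) → Prop) [DecidablePred P] (n : ℕ) :
    ({f : F[X] | f.degree = n ∧ PowerFree m f ∧ ∃ τ, HasType f τ ∧ P τ}.ncard : ℝ) /
      (Fintype.card F : ℝ) ^ n =
      ∑ τ : F → Fin m × Fˣ with P τ, (∏ a, localWeight (τ a)) * typeDensity τ n := by
  have hq := (cardF_pos (F := F)).ne'
  have hfin : ∀ Q : F[X] → Prop, {f : F[X] | f.degree = n ∧ Q f}.Finite := fun Q =>
    (finite_degree_eq n).subset fun f hf => hf.1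
  have hun : {f : F[X] | f.degree = n ∧ PowerFree m f ∧ ∃ τ, HasType f τ ∧ P τ} =
      ((Finset.univ.filter fun τ : F → Fin m × Fˣ => P τ).biUnion fun τ =>
        (hfin fun f => HasType f τ ∧ PowerFree m f).toFinset : Finset F[X]) := by
    ext f
    simp only [Finset.coe_biUnion, Finset.coe_filter, Finset.mem_univ, true_and, Set.mem_iUnion,
      Set.mem_ofPred_eq, Set.Finite.coe_toFinset, exists_prop]
    constructor
    · rintro ⟨hd, hf, τ, ht, hP⟩
      exact ⟨τ, hP, hd, ht, hf⟩
    · rintro ⟨τ, hP, hd, ht, hf⟩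
      exact ⟨hd, hf, τ, ht, hP⟩
  rw [hun, Set.ncard_coe_finset, Finset.card_biUnion, Nat.cast_sum, Finset.sum_div]
  · refine Finset.sum_congr rfl fun τ _ => ?_
    rw [prod_localWeight, typeDensity, Set.ncard_eq_toFinset_card _ (hfin _)]
    field_simp
  · intro τ _ τ' _ hne
    refine Finset.disjoint_left.2 fun f hf hf' => hne ?_
    rw [Set.Finite.mem_toFinset] at hf hf'
    exact hf.2.1.unique hf'.2.1

open Classical in
/-- If for all nondegenerate `f` the condition `Q` holds and the number of points is determined by
the local type, then the proportions converge to the weight of the types with `k` points. -/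
theorem tendsto_proportion (hm : 2 ≤ m) (hqm : Nat.Coprime (Fintype.card F) m)
    {Q : F[X] → Prop} (hQ : ∀ f : F[X], PowerFree m f → ¬ IsDegenerate m f → Q f)
    (hN : ∀ (f : F[X]) (τ : F → Fin m × Fˣ), ¬ IsDegenerate m f → HasType f τ →
      numPoints m f = ∑ a, localPoints (τ a)) (k : ℕ) :
    Tendsto (fun d => proportion m Q k d) atTop (𝓝
      ((∑ τ : F → Fin m × Fˣ with ∑ a, localPoints (τ a) = k, ∏ a, localWeight (τ a)) /
        ∑ τ : F → Fin m × Fˣ, ∏ a, localWeight (τ a))) := by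
  set q : ℝ := (Fintype.card F : ℝ) with hq
  have hq0 : 0 < q := cardF_pos
  set L := (∑ τ : F → Fin m × Fˣ with ∑ a, localPoints (τ a) = k, ∏ a, localWeight (τ a)) /
    ∑ τ : F → Fin m × Fˣ, ∏ a, localWeight (τ a) with hL
  set x : ℕ → ℝ := fun n => ({f : F[X] | f.degree = n ∧ PowerFree m f ∧
    ∃ τ, HasType f τ ∧ ∑ a, localPoints (τ a) = k}.ncard : ℝ) / q ^ n with hx
  set y : ℕ → ℝ := fun n => ({f : F[X] | f.degree = n ∧ PowerFree m f}.ncard : ℝ) / q ^ n with hy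
  set x' : ℕ → ℝ := fun n => ({f : F[X] | f.degree = n ∧ PowerFree m f ∧ Q f ∧
    numPoints m f = k}.ncard : ℝ) / q ^ n with hx'
  set y' : ℕ → ℝ := fun n => ({f : F[X] | f.degree = n ∧ PowerFree m f ∧ Q f}.ncard : ℝ) / q ^ n
    with hy'
  have hxx : Tendsto (fun n => x' n - x n) atTop (𝓝 0) := by
    refine squeeze_zero_norm (fun n => ?_) (tendsto_ncard_isDegenerate (F := F) (m := m) (by omega))
    rw [hx', hx]
    dsimp only
    rw [← sub_div, norm_div, Real.norm_of_nonneg (pow_nonneg hq0.le n), Real.norm_eq_abs]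
    gcongr
    refine abs_ncard_sub_le fun f hf => and_congr_right fun hpf => ?_
    obtain ⟨τ, hτ⟩ := hpf.exists_hasType
    rw [hN f τ hf hτ]
    exact ⟨fun h => ⟨τ, hτ, h.2⟩, fun ⟨τ', hτ', h⟩ => ⟨hQ f hpf hf, hτ.unique hτ' ▸ h⟩⟩
  have hyy : Tendsto (fun n => y' n - y n) atTop (𝓝 0) := by
    refine squeeze_zero_norm (fun n => ?_) (tendsto_ncard_isDegenerate (F := F) (m := m) (by omega))
    rw [hy', hy]
    dsimp only
    rw [← sub_div, norm_div, Real.norm_of_nonneg (pow_nonneg hq0.le n), Real.norm_eq_abs]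
    gcongr
    refine abs_ncard_sub_le fun f hf => ?_
    exact ⟨fun h => h.1, fun h => ⟨h, hQ f h hf⟩⟩
  have hy2 : ∀ n, 1 / 2 ≤ y n := fun n => by
    rw [hy, le_div_iff₀ (by positivity)]
    have := le_ncard_powerFree (F := F) hm hqm n
    linarith
  have hxy : Tendsto (fun n => x n - L * y n) atTop (𝓝 0) := by
    have hW : ∑ τ : F → Fin m × Fˣ, ∏ a, localWeight (τ a) ≠ 0 := by
      have : Nonempty (F → Fin m × Fˣ) := ⟨fun _ => (⟨0, by omega⟩, 1)⟩
      refine (Finset.sum_pos (fun τ _ => ?_) Finset.univ_nonempty).ne'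
      rw [prod_localWeight]
      positivity
    obtain ⟨K, t, ht0, ht1, hK⟩ := exists_typeDensity_sub_le (F := F) hm hqm
    have hA : ∀ τ τ' : F → Fin m × Fˣ,
        Tendsto (fun n => typeDensity τ n - typeDensity τ' n) atTop (𝓝 0) := fun τ τ' =>
      squeeze_zero_norm (fun n => hK n τ τ') (by
        simpa using (tendsto_pow_atTop_nhds_zero_of_lt_one ht0.le ht1).const_mul K)
    refine (tendsto_weighted_sum (Finset.univ.filter fun τ : F → Fin m × Fˣ =>
      ∑ a, localPoints (τ a) = k) hW hA).congr fun n => ?_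
    have h1 := ncard_powerFree_type (F := F) (m := m) (fun τ => ∑ a, localPoints (τ a) = k) n
    have h2 := ncard_powerFree_type (F := F) (m := m) (fun _ => True) n
    have h3 : {f : F[X] | f.degree = n ∧ PowerFree m f ∧
        ∃ τ : F → Fin m × Fˣ, HasType f τ ∧ True} = {f : F[X] | f.degree = n ∧ PowerFree m f} := by
      ext f
      exact ⟨fun h => ⟨h.1, h.2.1⟩, fun h =>
        ⟨h.1, h.2, h.2.exists_hasType.imp fun τ hτ => ⟨hτ, trivial⟩⟩⟩
    rw [h3, Finset.filter_true] at h2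
    rw [← h1, ← h2]
  refine (tendsto_div_of_sub_mul (x := x') (y := y') (L := L) (c := 1 / 4) (by norm_num) ?_ ?_).congr
    fun n => ?_
  · have := (hxx.add hxy).sub (hyy.const_mul L)
    simp only [add_zero, mul_zero, sub_zero] at this
    exact this.congr fun n => by ring
  · filter_upwards [hyy.eventually (Ioi_mem_nhds (show (-(1 / 4) : ℝ) < 0 by norm_num))] with n hn
    have := hy2 n
    have hn' : -(1 / 4) < y' n - y n := hn
    linarith
  · rw [proportion, hx', hy']
    dsimp only
    rw [div_div_div_cancel_right₀ (by positivity)]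

end Limits

/-! ### The coordinate ring and its fraction field -/

section Expansion

variable {F : Type*} [Field F] {m : ℕ} {f : F[X]} {L : Type*} [Field L] [Algebra F[X] L]

/-- Each term `c y ^ k / h` in the expansion of an integral element in powers of `y` is integral:
up to the factor `m` it is a combination, with roots of unity as coefficients, of the conjugates
of that element. -/
theorem isIntegral_coeff (hm : m ≠ 0) (hmF : (m : F) ≠ 0)
    (hinjL : Function.Injective (algebraMap F[X] L)) {y b : L}
    {E : Type*} [Field E] [Algebra L E] [Algebra F[X] E] [IsScalarTower F[X] L E] {w : E}
    (hw : IsPrimitiveRoot w m)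
    (htw : ∀ v : E, v ^ m = 1 → ∃ σ : L →ₐ[F[X]] E, σ y = v * algebraMap L E y)
    (hb : IsIntegral F[X] b) {h : F[X]} (hh : h ≠ 0) {p : F[X][X]} (hp : p.natDegree < m)
    (hbp : algebraMap F[X] _ h * b = aeval y p) {k : ℕ} (hk : k < m) :
    IsIntegral F[X] (algebraMap F[X] L (p.coeff k) * y ^ k /
      algebraMap F[X] _ h) := by
  have hL : ∀ {x : F[X]}, x ≠ 0 → algebraMap F[X] L x ≠ 0 := fun {x} hx =>
    (map_ne_zero_iff _ hinjL).2 hx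
  set β : ℕ → L := fun k => algebraMap F[X] L (p.coeff k) * y ^ k / algebraMap F[X] L h
    with hβ
  have hbsum : b = ∑ k ∈ Finset.range m, β k := by
    rw [hβ, ← Finset.sum_div, eq_div_iff (hL hh), mul_comm, hbp, aeval_eq_sum_range' hp]
    simp [Algebra.smul_def]
  have hwint : IsIntegral F[X] w := by
    refine ⟨X ^ m - 1, monic_X_pow_sub_C 1 hm, ?_⟩
    simp [hw.pow_eq_one]
  have hwi : ∀ i, (w ^ i) ^ m = 1 := fun i => by
    rw [← pow_mul, mul_comm, pow_mul, hw.pow_eq_one, one_pow]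
  choose σ hσ using fun i : ℕ => htw _ (hwi i)
  have hσβ : ∀ i j, σ i (β j) = w ^ (i * j) * algebraMap L E (β j) := by
    intro i j
    simp only [hβ, map_div₀, map_mul, map_pow, hσ, AlgHom.commutes,
      IsScalarTower.algebraMap_apply F[X] L E]
    ring
  have hsum : ∑ i ∈ Finset.range m, w ^ (i * (m - k)) * σ i b = m * algebraMap L E (β k) := by
    calc _ = ∑ i ∈ Finset.range m, ∑ j ∈ Finset.range m,
          (w ^ (m - k + j)) ^ i * algebraMap L E (β j) := by
          refine Finset.sum_congr rfl fun i _ => ?_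
          rw [hbsum, map_sum, Finset.mul_sum]
          refine Finset.sum_congr rfl fun j _ => ?_
          rw [hσβ, ← pow_mul, ← mul_assoc, ← pow_add]
          ring_nf
      _ = ∑ j ∈ Finset.range m, (∑ i ∈ Finset.range m, (w ^ (m - k + j)) ^ i) *
          algebraMap L E (β j) := by
          rw [Finset.sum_comm]
          simp_rw [Finset.sum_mul]
      _ = m * algebraMap L E (β k) := by
          rw [Finset.sum_eq_single k]
          · rw [Nat.sub_add_cancel hk.le, hw.pow_eq_one]
            simp
          · intro j hj hjk
            rw [Finset.mem_range] at hj
            have hne : w ^ (m - k + j) ≠ 1 := by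
              rw [Ne, hw.pow_eq_one_iff_dvd]
              rintro ⟨t, ht⟩
              have h1 : 0 < t := by
                rcases Nat.eq_zero_or_pos t with rfl | h0
                · omega
                · exact h0
              have h2 : t < 2 := by
                by_contra! h2
                have := Nat.mul_le_mul_left m h2
                omega
              have : t = 1 := by omega
              subst this
              omega
            have hg := mul_geom_sum (w ^ (m - k + j)) m
            rw [hwi, sub_self] at hg
            rw [(mul_eq_zero.1 hg).resolve_left (sub_ne_zero.2 hne), zero_mul]
          · intro h; exact absurd (Finset.mem_range.2 hk) h
  have hint : IsIntegral F[X] (∑ i ∈ Finset.range m, w ^ (i * (m - k)) * σ i b) :=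
    IsIntegral.sum _ fun i _ => (hwint.pow _).mul (hb.map (σ i))
  rw [hsum] at hint
  have hint2 : IsIntegral F[X] ((m : L) * β k) := by
    rw [← isIntegral_algebraMap_iff (algebraMap L E).injective, map_mul, map_natCast]
    exact hint
  have : β k = algebraMap F[X] L (C (m : F)⁻¹) * ((m : L) * β k) := by
    have h1 : (m : L) = algebraMap F[X] L (C (m : F)) := by simp
    rw [← mul_assoc, h1, ← map_mul, ← C_mul, inv_mul_cancel₀ hmF, C_1, map_one, one_mul]
  change IsIntegral F[X] (β k)
  rw [this]
  exact isIntegral_algebraMap.mul hint2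

/-- The `m`-th power of an integral element `c y ^ k / h` is a polynomial. -/
theorem exists_pow_eq (hinjL : Function.Injective (algebraMap F[X] L)) {y : L}
    (hy : y ^ m = algebraMap F[X] L f) {c h : F[X]} (hh : h ≠ 0) {k : ℕ}
    (hint : IsIntegral F[X] (algebraMap F[X] L c * y ^ k /
      algebraMap F[X] _ h)) :
    ∃ r : F[X], r * h ^ m = c ^ m * f ^ k ∧
      (algebraMap F[X] L c * y ^ k /
        algebraMap F[X] _ h) ^ m = algebraMap F[X] _ r := by
  have : FaithfulSMul F[X] L := (faithfulSMul_iff_algebraMap_injective _ _).2 hinjL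
  let := FractionRing.liftAlgebra F[X] L
  have := FractionRing.isScalarTower_liftAlgebra F[X] L
  set x : FractionRing F[X] := algebraMap _ _ (c ^ m * f ^ k) / algebraMap _ _ (h ^ m) with hx
  have hxL : algebraMap (FractionRing F[X]) L x =
      (algebraMap F[X] L c * y ^ k / algebraMap F[X] L h) ^ m := by
    rw [hx, map_div₀, ← IsScalarTower.algebraMap_apply, ← IsScalarTower.algebraMap_apply, div_pow,
      mul_pow, ← pow_mul, mul_comm k m, pow_mul, hy, map_mul, map_pow, map_pow, map_pow]
  have hxint : IsIntegral F[X] x := by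
    rw [← isIntegral_algebraMap_iff (algebraMap (FractionRing F[X]) L).injective, hxL]
    exact hint.pow m
  obtain ⟨r, hr⟩ := IsIntegrallyClosed.isIntegral_iff.1 hxint
  refine ⟨r, ?_, ?_⟩
  · apply IsFractionRing.injective F[X] (FractionRing F[X])
    rw [map_mul, hr, hx, div_mul_cancel₀]
    exact (map_ne_zero_iff _ (IsFractionRing.injective F[X] (FractionRing F[X]))).2
      (pow_ne_zero _ hh)
  · rw [← hxL, ← hr, ← IsScalarTower.algebraMap_apply]

end Expansion

section CoordRing

variable {F : Type*} [Field F] {m : ℕ} {f : F[X]}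

theorem monic_defining (hm : m ≠ 0) (f : F[X]) : (X ^ m - C f : F[X][X]).Monic :=
  monic_X_pow_sub_C _ hm

theorem algebraMap_coordRing_injective (hm : m ≠ 0) :
    Function.Injective (algebraMap F[X] (CoordRing m f)) := by
  refine AdjoinRoot.of.injective_of_degree_ne_zero ?_
  rw [degree_X_pow_sub_C (Nat.pos_of_ne_zero hm)]
  exact_mod_cast hm

theorem isIntegral_coordRing (hm : m ≠ 0) : Algebra.IsIntegral F[X] (CoordRing m f) :=
  have := (monic_defining hm f).finite_adjoinRoot
  Algebra.IsIntegral.of_finite _ _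

theorem algebraMap_fractionRing_injective (hm : m ≠ 0) :
    Function.Injective (algebraMap F[X] (FractionRing (CoordRing m f))) := by
  rw [IsScalarTower.algebraMap_eq F[X] (CoordRing m f)]
  exact (IsFractionRing.injective (CoordRing m f) _).comp (algebraMap_coordRing_injective hm)

/-- The function `y` on `C_f`, in the total ring of fractions. -/
noncomputable def rootY (m : ℕ) (f : F[X]) : FractionRing (CoordRing m f) :=
  algebraMap (CoordRing m f) _ (AdjoinRoot.root _)

theorem rootY_pow (m : ℕ) (f : F[X]) : rootY m f ^ m = algebraMap F[X] _ f := by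
  rw [rootY, ← map_pow, IsScalarTower.algebraMap_apply F[X] (CoordRing m f)]
  congr 1
  have := AdjoinRoot.eval₂_root (X ^ m - C f : F[X][X])
  rw [eval₂_sub, eval₂_pow, eval₂_X, eval₂_C, sub_eq_zero] at this
  exact this

theorem isIntegral_iff (hm : m ≠ 0) {b : FractionRing (CoordRing m f)} :
    IsIntegral (CoordRing m f) b ↔ IsIntegral F[X] b :=
  have := isIntegral_coordRing (f := f) hm
  ⟨fun h => isIntegral_trans b h, fun h => h.tower_top⟩

theorem aeval_rootY_eq (p : F[X][X]) : aeval (rootY m f) p =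
    algebraMap (CoordRing m f) (FractionRing (CoordRing m f))
      (AdjoinRoot.mk (X ^ m - C f : F[X][X]) p) := by
  rw [rootY, aeval_algebraMap_apply, ← AdjoinRoot.aeval_eq]

theorem eq_zero_of_aeval_rootY (hm : m ≠ 0) {p : F[X][X]} (hp : p.natDegree < m)
    (h : aeval (rootY m f) p = 0) : p = 0 := by
  by_contra hne
  rw [aeval_rootY_eq, map_eq_zero_iff _ (IsFractionRing.injective (CoordRing m f) _)] at h
  exact AdjoinRoot.mk_ne_zero_of_natDegree_lt (monic_defining hm f) hne
    (by rwa [natDegree_X_pow_sub_C]) h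

variable [IsDomain (CoordRing m f)]

theorem exists_mul_eq_aeval (hm : m ≠ 0) (b : FractionRing (CoordRing m f)) :
    ∃ (h : F[X]) (p : F[X][X]), h ≠ 0 ∧ p.natDegree < m ∧
      algebraMap F[X] _ h * b = aeval (rootY m f) p := by
  have := isIntegral_coordRing (f := f) hm
  have hinj := algebraMap_coordRing_injective (f := f) hm
  obtain ⟨x, s, hs, rfl⟩ := IsFractionRing.div_surjective (CoordRing m f) b
  obtain ⟨h, hh, d, hd⟩ := (Algebra.IsIntegral.isIntegral (R := F[X]) s).isAlgebraic.exists_nonzero_dvd hs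
  have hs0 : algebraMap (CoordRing m f) (FractionRing (CoordRing m f)) s ≠ 0 :=
    IsFractionRing.to_map_ne_zero_of_mem_nonZeroDivisors hs
  obtain ⟨p, hp⟩ := AdjoinRoot.mk_surjective (d * x)
  refine ⟨h, p %ₘ (X ^ m - C f), hh, ?_, ?_⟩
  · have := natDegree_modByMonic_lt p (monic_defining hm f) (by
      intro h1
      have := congrArg natDegree h1
      rw [natDegree_X_pow_sub_C, natDegree_one] at this
      exact hm this)
    rwa [natDegree_X_pow_sub_C] at this
  · have hmod : AdjoinRoot.mk (X ^ m - C f : F[X][X]) (p %ₘ (X ^ m - C f)) =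
        AdjoinRoot.mk (X ^ m - C f : F[X][X]) p := by
      rw [AdjoinRoot.mk_eq_mk, ← dvd_neg, neg_sub]
      exact ⟨p /ₘ (X ^ m - C f), by
        rw [sub_eq_iff_eq_add']; exact (modByMonic_add_div p _).symm⟩
    rw [aeval_rootY_eq, hmod, hp, IsScalarTower.algebraMap_apply F[X] (CoordRing m f), hd,
      map_mul, map_mul]
    field_simp

/-- The twist of the embedding of the function field by an `m`-th root of unity. -/
theorem exists_twist (hm : m ≠ 0) {E : Type*} [Field E] [Algebra (FractionRing (CoordRing m f)) E]
    [Algebra F[X] E] [IsScalarTower F[X] (FractionRing (CoordRing m f)) E] {w : E}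
    (hw : w ^ m = 1) :
    ∃ σ : FractionRing (CoordRing m f) →ₐ[F[X]] E,
      σ (rootY m f) = w * algebraMap _ E (rootY m f) := by
  have := isIntegral_coordRing (f := f) hm
  let σ₀ : CoordRing m f →ₐ[F[X]] E := AdjoinRoot.liftAlgHom _ (Algebra.ofId F[X] E)
    (w * algebraMap _ E (rootY m f)) (by
      rw [eval₂_sub, eval₂_pow, eval₂_X, eval₂_C, mul_pow, hw, one_mul, ← map_pow, rootY_pow,
        ← IsScalarTower.algebraMap_apply]
      exact sub_self _)
  have hinj : Function.Injective σ₀ := by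
    change Function.Injective (σ₀ : CoordRing m f →+* E)
    rw [RingHom.injective_iff_ker_eq_bot]
    refine Ideal.eq_bot_of_comap_eq_bot (R := F[X]) ?_
    rw [eq_bot_iff]
    intro p hp
    rw [Ideal.mem_comap, RingHom.mem_ker] at hp
    have hp' : algebraMap F[X] E p = 0 := by rw [← hp]; exact (σ₀.commutes p).symm
    rw [IsScalarTower.algebraMap_apply F[X] (FractionRing (CoordRing m f)), map_eq_zero] at hp'
    exact (map_eq_zero_iff _ (algebraMap_fractionRing_injective hm)).1 hp'
  refine ⟨IsFractionRing.liftAlgHom (K := FractionRing (CoordRing m f)) hinj, ?_⟩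
  rw [rootY]
  simp [σ₀, rootY]

end CoordRing

/-! ### Fibres of the normalization over the line -/

section Fibre

theorem rootMultiplicity_pow {R : Type*} [CommRing R] [IsDomain R] (p : R[X]) (n : ℕ) (a : R) :
    (p ^ n).rootMultiplicity a = n * p.rootMultiplicity a := by
  classical
  rw [← count_roots, ← count_roots, roots_pow, Multiset.count_nsmul]

variable {F : Type*} [Field F] {m : ℕ} {f : F[X]} {L : Type*} [Field L] [Algebra F[X] L]
  {B : Type*} [CommRing B] [Algebra F B] [Algebra F[X] B] [IsScalarTower F F[X] B]
  [Algebra B L] [IsScalarTower F[X] B L]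

theorem map_algebraMap_eq_eval {E : Type*} [CommRing E] [Algebra F E] {ψ : B →ₐ[F] E} {a : F}
    (hψ : ψ (algebraMap F[X] B X) = algebraMap F E a) (g : F[X]) :
    ψ (algebraMap F[X] B g) = algebraMap F E (g.eval a) := by
  have h : ψ.comp (IsScalarTower.toAlgHom F F[X] B) = aeval (algebraMap F E a) := by
    apply Polynomial.algHom_ext
    simpa using hψ
  have := DFunLike.congr_fun h g
  simp only [AlgHom.comp_apply, IsScalarTower.coe_toAlgHom'] at this
  rw [this, aeval_algebraMap_apply_eq_algebraMap_eval]

/-- A homomorphism over `x = a` takes a prescribed value at an integral element `c y ^ k / h`, once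
its value at `z = y ^ m' / (x - a) ^ s'` is prescribed: either `m ∣ k s` and the element is a power
of `z` up to functions on the line, or it vanishes above `x = a`. -/
theorem exists_value_of_term (hm : m ≠ 0) (hBL : Function.Injective (algebraMap B L))
    (hinjL : Function.Injective (algebraMap F[X] L))
    {y : L} {a : F} {s' m' e : ℕ} {u : F[X]}
    (hu : u.eval a ≠ 0) (hf : f = (X - C a) ^ (e * s') * u) (hme : m = e * m')
    (hcop : Nat.Coprime m' s') {z : B}
    (hz : algebraMap B L (algebraMap F[X] B ((X - C a) ^ s') * z) = y ^ m')
    {β : B} {r c h : F[X]} {k : ℕ} (hh : h ≠ 0) (hβ : algebraMap B L (algebraMap F[X] B h * β) =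
      algebraMap B L (algebraMap F[X] B c) * y ^ k)
    (hr : r * h ^ m = c ^ m * f ^ k) (hrβ : β ^ m = algebraMap F[X] B r) (ζ : F) :
    ∃ v : F, ∀ (E : Type*) [CommRing E] [IsReduced E] [Algebra F E] (ψ : B →ₐ[F] E),
      ψ (algebraMap F[X] B X) = algebraMap F E a → ψ z = algebraMap F E ζ →
      ψ β = algebraMap F E v := by
  have hu0 : u ≠ 0 := by rintro rfl; simp at hu
  have ht0 : X - C a ≠ 0 := X_sub_C_ne_zero a
  have he : e ≠ 0 := by rintro rfl; simp at hme; exact hm hme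
  by_cases hdvd : m' ∣ k
  · obtain ⟨l, rfl⟩ := hdvd
    obtain ⟨h₁, hh₁, hh₁a⟩ := exists_eq_pow_rootMultiplicity_mul_and_not_dvd h hh a
    set j := h.rootMultiplicity a
    rw [dvd_iff_isRoot, IsRoot] at hh₁a
    obtain ⟨d, hd⟩ : (X - C a) ^ j ∣ c * (X - C a) ^ (s' * l) := by
      rw [← IsIntegrallyClosed.pow_dvd_pow_iff hm]
      have hcop' : IsCoprime (((X - C a) ^ j) ^ m) (u ^ (m' * l)) := by
        refine IsCoprime.pow (IsCoprime.pow_left ?_)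
        rw [(prime_X_sub_C a).coprime_iff_not_dvd, dvd_iff_isRoot]
        exact hu
      refine hcop'.dvd_of_dvd_mul_right (Dvd.intro (r * h₁ ^ m) ?_)
      calc ((X - C a) ^ j) ^ m * (r * h₁ ^ m) = r * h ^ m := by rw [hh₁]; ring
        _ = c ^ m * f ^ (m' * l) := hr
        _ = _ := by rw [hf, hme]; ring
    have hrel : algebraMap F[X] B h₁ * β = algebraMap F[X] B d * z ^ l := by
      apply hBL
      have htL : algebraMap B L (algebraMap F[X] B ((X - C a) ^ j)) ≠ 0 := by
        rw [← IsScalarTower.algebraMap_apply, map_ne_zero_iff _ hinjL]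
        exact pow_ne_zero _ ht0
      refine mul_left_cancel₀ htL ?_
      calc _ = algebraMap B L (algebraMap F[X] B h * β) := by
            conv_rhs => rw [hh₁]
            simp only [map_mul]; ring
        _ = algebraMap B L (algebraMap F[X] B c) *
            (algebraMap B L (algebraMap F[X] B ((X - C a) ^ s') * z)) ^ l := by
            rw [hβ, hz, ← pow_mul]
        _ = algebraMap B L (algebraMap F[X] B (c * (X - C a) ^ (s' * l))) *
            algebraMap B L (z ^ l) := by
            simp only [map_mul, map_pow, mul_pow]; ring
        _ = _ := by rw [hd]; simp only [map_mul]; ring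
    refine ⟨d.eval a * ζ ^ l / h₁.eval a, fun E _ _ _ ψ hψX hψz => ?_⟩
    have := congrArg ψ hrel
    rw [map_mul, map_mul, map_pow, map_algebraMap_eq_eval hψX, map_algebraMap_eq_eval hψX, hψz,
      ← map_pow, ← map_mul] at this
    have h1 : algebraMap F E (h₁.eval a)⁻¹ * algebraMap F E (h₁.eval a) = 1 := by
      rw [← map_mul, inv_mul_cancel₀ hh₁a, map_one]
    calc ψ β = algebraMap F E (h₁.eval a)⁻¹ * (algebraMap F E (h₁.eval a) * ψ β) := by
          rw [← mul_assoc, h1, one_mul]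
      _ = _ := by rw [this, ← map_mul]; congr 1; ring
  · have hra : r.eval a = 0 := by
      by_contra hra
      have hr0 : r ≠ 0 := by rintro rfl; simp at hra
      have hf0 : f ≠ 0 := by rw [hf]; exact mul_ne_zero (pow_ne_zero _ ht0) hu0
      have hc0 : c ≠ 0 := by
        rintro rfl
        rw [zero_pow hm, zero_mul] at hr
        exact mul_ne_zero hr0 (pow_ne_zero _ hh) hr
      have hmult := congrArg (rootMultiplicity a) hr
      have hfm : f.rootMultiplicity a = e * s' := by
        rw [hf, rootMultiplicity_mul (mul_ne_zero (pow_ne_zero _ ht0) hu0),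
          rootMultiplicity_X_sub_C_pow, rootMultiplicity_eq_zero hu, add_zero]
      rw [rootMultiplicity_mul (mul_ne_zero hr0 (pow_ne_zero _ hh)),
        rootMultiplicity_mul (mul_ne_zero (pow_ne_zero _ hc0) (pow_ne_zero _ hf0)),
        rootMultiplicity_pow, rootMultiplicity_pow, rootMultiplicity_pow,
        rootMultiplicity_eq_zero hra, zero_add, hfm, hme] at hmult
      have h1 : e * m' ∣ k * (e * s') :=
        (Nat.dvd_add_right (Dvd.intro _ rfl)).1 (hmult ▸ Dvd.intro _ rfl)
      rw [mul_left_comm] at h1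
      exact hdvd (hcop.dvd_of_dvd_mul_right (Nat.dvd_of_mul_dvd_mul_left (Nat.pos_of_ne_zero he) h1))
    refine ⟨0, fun E _ _ _ ψ hψX hψz => ?_⟩
    rw [map_zero]
    refine pow_eq_zero_iff hm |>.1 ?_
    rw [← map_pow, hrβ, map_algebraMap_eq_eval hψX, hra, map_zero]

/-- There is a homomorphism to a domain with prescribed values at `x` and at
`z = y ^ m' / (x - a) ^ s'`, as long as these satisfy the equation `z ^ e = u(x)`. -/
theorem exists_prime_fibre (hm : m ≠ 0) [Algebra.IsIntegral F[X] B]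
    {y : L} (hlin : ∀ p : F[X][X], p.natDegree < m → aeval y p = 0 → p = 0)
    {a : F} {s' m' e : ℕ} {u : F[X]} (hme : m = e * m') {z : B}
    (hz : algebraMap B L (algebraMap F[X] B ((X - C a) ^ s') * z) = y ^ m')
    (hzu : z ^ e = algebraMap F[X] B u) {ζ : F} (hζ : ζ ^ e = u.eval a) :
    ∃ Q : Ideal B, Q.IsPrime ∧ algebraMap F[X] B (X - C a) ∈ Q ∧ z - algebraMap F B ζ ∈ Q := by
  have he : e ≠ 0 := by rintro rfl; simp at hme; exact hm hme
  have hm' : m' ≠ 0 := by rintro rfl; simp at hme; exact hm hme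
  -- the two-variable polynomial ring maps to `B` by `Z ↦ z`, and to `F` by evaluation
  let φ : F[X][X] →ₐ[F[X]] B := aeval z
  let ev : F[X][X] →+* F := eval₂RingHom (evalRingHom a) ζ
  let := φ.toRingHom.toAlgebra
  have : IsScalarTower F[X] F[X][X] B := .of_algebraMap_eq fun x => (φ.commutes x).symm
  have : Algebra.IsIntegral F[X][X] B := Algebra.IsIntegral.tower_top F[X]
  have hker : Ideal.comap (algebraMap F[X][X] B) ⊥ ≤ RingHom.ker ev := by
    intro g hg
    rw [Ideal.mem_comap, Ideal.mem_bot] at hg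
    have hmon : (X ^ e - C u : F[X][X]).Monic := monic_X_pow_sub_C _ he
    set ρ := g %ₘ (X ^ e - C u) with hρ
    have hg' : g = ρ + (X ^ e - C u) * (g /ₘ (X ^ e - C u)) := (modByMonic_add_div g _).symm
    have hrdeg : ρ.natDegree < e := by
      have := natDegree_modByMonic_lt g hmon (by
        intro h1
        have := congrArg natDegree h1
        rw [natDegree_X_pow_sub_C, natDegree_one] at this
        exact he this)
      rwa [natDegree_X_pow_sub_C] at this
    have hρz : aeval z ρ = 0 := by
      have h1 : aeval z g = 0 := hg
      rw [hg', map_add, map_mul] at h1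
      simpa [hzu] using h1
    have hρ0 : ρ = 0 := by
      -- clear denominators in `ρ(y ^ m' / (x - a) ^ s') = 0`
      set t : F[X] := (X - C a) ^ s'
      have ht : t ≠ 0 := pow_ne_zero _ (X_sub_C_ne_zero a)
      set P : F[X][X] := ∑ l ∈ Finset.range e,
        C (ρ.coeff l * t ^ (e - 1 - l)) * X ^ (m' * l) with hP
      have hcoeff : ∀ l < e, P.coeff (m' * l) = ρ.coeff l * t ^ (e - 1 - l) := by
        intro l hl
        rw [hP, finsetSum_coeff, Finset.sum_eq_single l]
        · rw [coeff_C_mul, coeff_X_pow, if_pos rfl, mul_one]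
        · intro l' _ hne
          rw [coeff_C_mul, coeff_X_pow, if_neg, mul_zero]
          exact fun h => hne (Nat.eq_of_mul_eq_mul_left (Nat.pos_of_ne_zero hm') h).symm
        · intro h; exact absurd (Finset.mem_range.2 hl) h
      have hPdeg : P.natDegree < m := by
        refine lt_of_le_of_lt (natDegree_sum_le_of_forall_le (n := m' * (e - 1)) _ _ fun l hl => ?_) ?_
        · refine (natDegree_C_mul_X_pow_le _ _).trans (Nat.mul_le_mul_left _ ?_)
          have := Finset.mem_range.1 hl
          omega
        · rw [hme, mul_comm e m']
          exact Nat.mul_lt_mul_of_pos_left (by omega) (Nat.pos_of_ne_zero hm')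
      have hPy : aeval y P = 0 := by
        have : aeval y P = algebraMap B L (algebraMap F[X] B (t ^ (e - 1)) * aeval z ρ) := by
          rw [aeval_eq_sum_range' hrdeg, hP, map_sum, Finset.mul_sum, map_sum]
          refine Finset.sum_congr rfl fun l hl => ?_
          have hl' : e - 1 = (e - 1 - l) + l := by have := Finset.mem_range.1 hl; omega
          rw [map_mul, aeval_C, map_pow, aeval_X, pow_mul, ← hz, Algebra.smul_def]
          conv_rhs => rw [hl', pow_add]
          simp only [map_mul, map_pow, mul_pow, IsScalarTower.algebraMap_apply F[X] B L]
          ring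
        rw [this, hρz, mul_zero, map_zero]
      have hP0 := hlin P hPdeg hPy
      ext1 l
      rw [coeff_zero]
      rcases lt_or_ge l e with hl | hl
      · have := hcoeff l hl
        rw [hP0, coeff_zero] at this
        exact (mul_eq_zero.1 this.symm).resolve_right (pow_ne_zero _ ht)
      · exact coeff_eq_zero_of_natDegree_lt (hrdeg.trans_le hl)
    rw [RingHom.mem_ker, hg', hρ0, zero_add, map_mul]
    simp [ev, hζ]
  have := RingHom.ker_isPrime ev
  obtain ⟨Q, -, hQ, hQc⟩ := Ideal.exists_ideal_over_prime_of_isIntegral (RingHom.ker ev)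
    (⊥ : Ideal B) hker
  have hmem : ∀ g : F[X][X], ev g = 0 → aeval z g ∈ Q := by
    intro g hg
    have : g ∈ Ideal.comap (algebraMap F[X][X] B) Q := by rw [hQc]; exact hg
    exact this
  refine ⟨Q, hQ, ?_, ?_⟩
  · have := hmem (C (X - C a)) (by simp [ev])
    rwa [aeval_C] at this
  · have := hmem (X - C (C ζ)) (by simp [ev])
    simp only [map_sub, aeval_X, aeval_C] at this
    rwa [IsScalarTower.algebraMap_apply F F[X] B]

end Fibre

section NumPoints

variable {F : Type*} [Field F] {m : ℕ} {f : F[X]}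

theorem isIntegral_normRing (hm : m ≠ 0) : Algebra.IsIntegral F[X] (NormRing m f) :=
  have := isIntegral_coordRing (f := f) hm
  Algebra.IsIntegral.trans (CoordRing m f)

theorem exists_normRing_eq (hm : m ≠ 0) {b : FractionRing (CoordRing m f)}
    (hb : IsIntegral F[X] b) : ∃ c : NormRing m f, algebraMap _ (FractionRing _) c = b :=
  ⟨⟨b, (isIntegral_iff hm).2 hb⟩, rfl⟩

variable [IsDomain (CoordRing m f)]

/-- A homomorphism on the normalization over `x = a` is determined by its value at
`z = y ^ m' / (x - a) ^ s'`. -/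
theorem exists_value (hm : m ≠ 0) (hmF : (m : F) ≠ 0) {a : F} {s' m' e : ℕ} {u : F[X]}
    (hu : u.eval a ≠ 0) (hf : f = (X - C a) ^ (e * s') * u) (hme : m = e * m')
    (hcop : Nat.Coprime m' s') {z : NormRing m f}
    (hz : algebraMap _ (FractionRing (CoordRing m f))
      (algebraMap F[X] (NormRing m f) ((X - C a) ^ s') * z) = rootY m f ^ m')
    (ζ : F) (b : NormRing m f) :
    ∃ v : F, ∀ (E : Type*) [CommRing E] [IsReduced E] [Algebra F E] (ψ : NormRing m f →ₐ[F] E),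
      ψ (algebraMap F[X] _ X) = algebraMap F E a → ψ z = algebraMap F E ζ →
      ψ b = algebraMap F E v := by
  have hinjL := algebraMap_fractionRing_injective (f := f) hm
  have hBL : Function.Injective
      (algebraMap (NormRing m f) (FractionRing (CoordRing m f))) := Subtype.val_injective
  have hint := isIntegral_normRing (f := f) hm
  obtain ⟨h, p, hh, hp, hbp⟩ := exists_mul_eq_aeval hm
    (algebraMap (NormRing m f) (FractionRing (CoordRing m f)) b)
  have hb : IsIntegral F[X] (algebraMap (NormRing m f) (FractionRing (CoordRing m f)) b) :=
    (hint.isIntegral b).algebraMap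
  have hhL := (map_ne_zero_iff _ hinjL).2 hh
  have hmE : NeZero (m : AlgebraicClosure (FractionRing (CoordRing m f))) := by
    refine ⟨?_⟩
    have : (m : AlgebraicClosure (FractionRing (CoordRing m f))) =
        algebraMap (FractionRing (CoordRing m f)) _ (algebraMap F[X] _ (C (m : F))) := by simp
    rw [this, _root_.map_ne_zero, map_ne_zero_iff _ hinjL]
    exact C_ne_zero.2 hmF
  obtain ⟨w, hw⟩ := HasEnoughRootsOfUnity.exists_primitiveRoot
    (AlgebraicClosure (FractionRing (CoordRing m f))) m
  have hterm : ∀ k, ∃ β : NormRing m f, k < m →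
      algebraMap _ (FractionRing (CoordRing m f)) β =
        algebraMap F[X] _ (p.coeff k) * rootY m f ^ k / algebraMap F[X] _ h := by
    intro k
    by_cases hk : k < m
    · obtain ⟨β, hβ⟩ := exists_normRing_eq hm (isIntegral_coeff hm hmF hinjL hw
        (fun v hv => exists_twist hm hv) hb hh hp hbp hk)
      exact ⟨β, fun _ => hβ⟩
    · exact ⟨0, fun h => absurd h hk⟩
  choose β hβ using hterm
  have hbsum : b = ∑ k ∈ Finset.range m, β k := by
    apply hBL
    rw [map_sum, Finset.sum_congr rfl fun k hk => hβ k (Finset.mem_range.1 hk), ← Finset.sum_div,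
      eq_div_iff hhL, mul_comm, hbp, aeval_eq_sum_range' hp]
    exact Finset.sum_congr rfl fun k _ => Algebra.smul_def _ _
  have hval : ∀ k, ∃ v : F, k < m → ∀ (E : Type _) [CommRing E] [IsReduced E] [Algebra F E]
      (ψ : NormRing m f →ₐ[F] E), ψ (algebraMap F[X] _ X) = algebraMap F E a →
      ψ z = algebraMap F E ζ → ψ (β k) = algebraMap F E v := by
    intro k
    by_cases hk : k < m
    · have hint' : IsIntegral F[X] (algebraMap F[X] (FractionRing (CoordRing m f)) (p.coeff k) *
          rootY m f ^ k / algebraMap F[X] _ h) := by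
        rw [← hβ k hk]
        exact (hint.isIntegral _).algebraMap
      obtain ⟨r, hr, hrL⟩ := exists_pow_eq hinjL (rootY_pow m f) hh hint'
      obtain ⟨v, hv⟩ := exists_value_of_term hm hBL hinjL hu hf hme hcop hz (β := β k) (r := r)
        (c := p.coeff k) (h := h) (k := k) hh (by
          rw [map_mul, hβ k hk, ← IsScalarTower.algebraMap_apply,
            ← IsScalarTower.algebraMap_apply, mul_div_cancel₀ _ hhL]) hr (by
          apply hBL
          rw [map_pow, hβ k hk, hrL, ← IsScalarTower.algebraMap_apply]) ζ
      exact ⟨v, fun _ => hv⟩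
    · exact ⟨0, fun h => absurd h hk⟩
  choose v hv using hval
  refine ⟨∑ k ∈ Finset.range m, v k, fun E _ _ _ ψ h₁ h₂ => ?_⟩
  rw [hbsum, map_sum, map_sum]
  exact Finset.sum_congr rfl fun k hk => hv k (Finset.mem_range.1 hk) E ψ h₁ h₂

end NumPoints

/-! ### Counting rational points -/

section Fibre

universe v

variable {F : Type v} [Field F] {B : Type v} [CommRing B] [Algebra F B]
  {x z : B} {a : F}

/-- If the values of homomorphisms on `B` over `x = a` are determined by the value at `z`, then
these homomorphisms are classified by the values at `z` that occur in some residue domain. -/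
theorem nonempty_algHom_equiv {S : F → Prop} (hS : ∀ φ : B →ₐ[F] F, φ x = a → S (φ z))
    (hval : ∀ (ζ : F) (b : B), ∃ v : F, ∀ (E : Type v) [CommRing E] [IsReduced E] [Algebra F E]
      (ψ : B →ₐ[F] E), ψ x = algebraMap F E a → ψ z = algebraMap F E ζ → ψ b = algebraMap F E v)
    (hQ : ∀ ζ, S ζ → ∃ Q : Ideal B, Q.IsPrime ∧ x - algebraMap F B a ∈ Q ∧
      z - algebraMap F B ζ ∈ Q) :
    Nonempty ({φ : B →ₐ[F] F // φ x = a} ≃ {ζ : F // S ζ}) := by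
  refine ⟨Equiv.ofBijective (fun φ => ⟨φ.1 z, hS φ.1 φ.2⟩) ⟨?_, ?_⟩⟩
  · rintro ⟨φ, hφ⟩ ⟨φ', hφ'⟩ h
    have h' : φ z = φ' z := congrArg Subtype.val h
    refine Subtype.ext (AlgHom.ext fun b => ?_)
    obtain ⟨v, hv⟩ := hval (φ z) b
    exact (hv F φ hφ rfl).trans (hv F φ' hφ' h'.symm).symm
  · rintro ⟨ζ, hζ⟩
    obtain ⟨Q, hQ, hQX, hQz⟩ := hQ ζ hζ
    let ψ : B →ₐ[F] B ⧸ Q := Ideal.Quotient.mkₐ F Q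
    have hψX : ψ x = algebraMap F _ a := by
      have h1 : ψ (x - algebraMap F _ a) = 0 := Ideal.Quotient.eq_zero_iff_mem.2 hQX
      rwa [map_sub, sub_eq_zero, ψ.commutes] at h1
    have hψz : ψ z = algebraMap F _ ζ := by
      have h1 : ψ (z - algebraMap F _ ζ) = 0 := Ideal.Quotient.eq_zero_iff_mem.2 hQz
      rwa [map_sub, sub_eq_zero, ψ.commutes] at h1
    -- all values of `ψ` lie in `F`
    have hbij : Function.Bijective (algebraMap F (B ⧸ Q)) := by
      refine ⟨(algebraMap F _).injective, fun y => ?_⟩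
      obtain ⟨b, rfl⟩ := Ideal.Quotient.mkₐ_surjective F Q y
      obtain ⟨v, hv⟩ := hval ζ b
      exact ⟨v, (hv _ ψ hψX hψz).symm⟩
    let ι : F ≃ₐ[F] B ⧸ Q := AlgEquiv.ofBijective (Algebra.ofId F _) hbij
    have hι : ∀ c : F, ι.symm (algebraMap F _ c) = c := fun c => ι.symm.commutes c
    refine ⟨⟨ι.symm.toAlgHom.comp ψ, ?_⟩, Subtype.ext ?_⟩
    · exact (congrArg ι.symm hψX).trans (hι a)
    · exact (congrArg ι.symm hψz).trans (hι ζ)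

end Fibre

section PointCount

variable {F : Type*} [Field F] {m : ℕ} {f : F[X]} [IsDomain (CoordRing m f)]

/-- The rational points above `x = a` correspond to the `e`-th roots in `F` of the leading
coefficient of `f` at `a`, where `e = (m, s)` and `s` is the order of vanishing of `f` at `a`: such
a root is the value at the point of `z = y ^ (m / e) / (x - a) ^ (s / e)`. -/
theorem nonempty_fibre_equiv (hm : m ≠ 0) (hmF : (m : F) ≠ 0) {τ : F → Fin m × Fˣ}
    (hτ : HasType f τ) (a : F) :
    Nonempty ({φ : NormRing m f →ₐ[F] F // φ (algebraMap F[X] (NormRing m f) X) = a} ≃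
      {z : F // z ^ Nat.gcd m (τ a).1 = (τ a).2}) := by
  have hinjL := algebraMap_fractionRing_injective (f := f) hm
  have hBL : Function.Injective
      (algebraMap (NormRing m f) (FractionRing (CoordRing m f))) := Subtype.val_injective
  have hint := isIntegral_normRing (f := f) hm
  obtain ⟨u, hf, hu⟩ := hτ.exists_eq a
  have hu0 : u.eval a ≠ 0 := by rw [hu]; exact (τ a).2.ne_zero
  set s : ℕ := ((τ a).1 : ℕ) with hs
  set e := Nat.gcd m s with he
  have hepos : 0 < e := Nat.gcd_pos_of_pos_left _ (Nat.pos_of_ne_zero hm)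
  obtain ⟨m', s', hcop, hme, hse⟩ := Nat.exists_coprime m s
  rw [← he, mul_comm] at hme hse
  have ht0 : (X - C a) ^ s' ≠ 0 := pow_ne_zero _ (X_sub_C_ne_zero a)
  have htL := (map_ne_zero_iff _ hinjL).2 ht0
  rw [hse] at hf
  have hzuL : (rootY m f ^ m' / algebraMap F[X] (FractionRing (CoordRing m f)) ((X - C a) ^ s')) ^ e =
      algebraMap F[X] _ u := by
    have hym : (rootY m f ^ m') ^ e = algebraMap F[X] _ f := by
      rw [← pow_mul, mul_comm, ← hme, rootY_pow]
    rw [div_pow, hym, div_eq_iff (pow_ne_zero _ htL), ← map_pow, ← map_mul]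
    congr 1
    rw [← pow_mul, mul_comm s' e, mul_comm u]
    exact hf
  obtain ⟨z, hz⟩ := exists_normRing_eq hm (b := rootY m f ^ m' /
    algebraMap F[X] (FractionRing (CoordRing m f)) ((X - C a) ^ s'))
    (IsIntegral.of_pow hepos (by rw [hzuL]; exact isIntegral_algebraMap))
  have hzt : algebraMap _ (FractionRing (CoordRing m f))
      (algebraMap F[X] (NormRing m f) ((X - C a) ^ s') * z) = rootY m f ^ m' := by
    rw [map_mul, hz, ← IsScalarTower.algebraMap_apply, mul_div_cancel₀ _ htL]
  have hzu : z ^ e = algebraMap F[X] _ u := by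
    apply hBL
    rw [map_pow, hz, hzuL, ← IsScalarTower.algebraMap_apply]
  refine nonempty_algHom_equiv (z := z) (fun φ hφ => ?_)
    (exists_value hm hmF hu0 hf hme hcop hzt) fun ζ hζ => ?_
  · rw [← map_pow, hzu, map_algebraMap_eq_eval hφ u, hu]
    rfl
  · have hlin : ∀ p : F[X][X], p.natDegree < m → aeval (rootY m f) p = 0 → p = 0 :=
      fun p hp h => eq_zero_of_aeval_rootY hm hp h
    have hζu : ζ ^ e = u.eval a := hζ.trans hu.symm
    obtain ⟨Q, hQ, hQX, hQz⟩ := exists_prime_fibre (B := NormRing m f)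
      (L := FractionRing (CoordRing m f)) (y := rootY m f) hm hlin hme hzt hzu hζu
    refine ⟨Q, hQ, ?_, hQz⟩
    rw [IsScalarTower.algebraMap_apply F F[X] (NormRing m f), ← map_sub]
    exact hQX

/-- The number of rational points of an integral curve, in terms of local types. -/
theorem numPoints_eq [Fintype F] (hm : m ≠ 0) (hmF : (m : F) ≠ 0) {τ : F → Fin m × Fˣ}
    (hτ : HasType f τ) : numPoints m f = ∑ a, localPoints (τ a) := by
  classical
  have hfin : ∀ a, Finite {φ : NormRing m f →ₐ[F] F //
      φ (algebraMap F[X] (NormRing m f) X) = a} := fun a =>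
    Finite.of_equiv _ (nonempty_fibre_equiv hm hmF hτ a).some.symm
  rw [numPoints, Nat.card_congr (Equiv.sigmaFiberEquiv
    fun φ : NormRing m f →ₐ[F] F => φ (algebraMap F[X] _ X)).symm, Nat.card_sigma]
  exact Finset.sum_congr rfl fun a _ =>
    Nat.card_congr (nonempty_fibre_equiv hm hmF hτ a).some

end PointCount

/-! ### Integral curves and their function fields as Kummer extensions -/

section Domain

variable {F : Type*} [Field F] {m : ℕ} {f : F[X]}

/-- `C_f` is reduced when `m` is invertible, as `y ^ m - f` is then separable over the function
field of the line. -/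
theorem isReduced_coordRing (hm : m ≠ 0) (hmF : (m : F) ≠ 0) (hf : f ≠ 0) :
    IsReduced (CoordRing m f) := by
  set K := FractionRing F[X]
  have hinj := IsFractionRing.injective F[X] K
  have hmK : (m : K) ≠ 0 := by
    have : (m : K) = algebraMap F[X] K (C (m : F)) := by simp
    rw [this]
    exact (map_ne_zero_iff _ hinj).2 (C_ne_zero.2 hmF)
  have hsep : (X ^ m - C (algebraMap F[X] K f)).Separable :=
    separable_X_pow_sub_C _ hmK ((map_ne_zero_iff _ hinj).2 hf)
  have hmap : (X ^ m - C f : F[X][X]).map (algebraMap F[X] K) =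
      X ^ m - C (algebraMap F[X] K f) := by simp
  refine ⟨fun a ha => ?_⟩
  obtain ⟨n, hn⟩ := ha
  obtain ⟨p, rfl⟩ := AdjoinRoot.mk_surjective a
  rw [← map_pow, AdjoinRoot.mk_eq_zero, ← map_dvd_map _ hinj (monic_defining hm f), hmap,
    Polynomial.map_pow] at hn
  rw [AdjoinRoot.mk_eq_zero, ← map_dvd_map _ hinj (monic_defining hm f), hmap]
  exact hsep.squarefree.isRadical n _ hn

/-- A curve `C_f` with irreducible normalization is integral. -/
theorem isDomain_coordRing (hm : m ≠ 0) (hmF : (m : F) ≠ 0) (hf : f ≠ 0)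
    (h : NormIrreducible m f) : IsDomain (CoordRing m f) := by
  have := isReduced_coordRing hm hmF hf
  have hp := PrimeSpectrum.irreducibleSpace_iff_isPrime_nilradical.1 h
  have hinj : Function.Injective (algebraMap (CoordRing m f) (NormRing m f)) := by
    have := IsFractionRing.injective (CoordRing m f) (FractionRing (CoordRing m f))
    rw [IsScalarTower.algebraMap_eq (CoordRing m f) (NormRing m f), RingHom.coe_comp] at this
    exact this.of_comp
  have hbot : (nilradical (NormRing m f)).comap (algebraMap (CoordRing m f) (NormRing m f)) = ⊥ := by
    rw [eq_bot_iff]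
    intro a ha
    rw [Ideal.mem_comap, mem_nilradical] at ha
    exact ((IsNilpotent.map_iff hinj).1 ha).eq_zero
  have hprime : (⊥ : Ideal (CoordRing m f)).IsPrime := hbot ▸ hp.comap _
  exact IsDomain.of_bot_isPrime (CoordRing m f)

/-- `C_f` is integral if and only if its generic fibre over the line is, by Gauss's lemma. -/
theorem isDomain_coordRing_iff (hm : m ≠ 0) (K : Type*) [Field K] [Algebra F[X] K]
    [IsFractionRing F[X] K] :
    IsDomain (CoordRing m f) ↔ Irreducible (X ^ m - C (algebraMap F[X] K f)) := by
  have hmap : (X ^ m - C f : F[X][X]).map (algebraMap F[X] K) =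
      X ^ m - C (algebraMap F[X] K f) := by simp
  have hmon := monic_defining hm f
  rw [← hmap, ← hmon.irreducible_iff_irreducible_map_fraction_map, irreducible_iff_prime,
    ← Ideal.span_singleton_prime hmon.ne_zero, ← Ideal.Quotient.isDomain_iff_prime]
  rfl

/-- The normalization of `C_f` is the integral closure of `F[x]` in the ring of rational
functions. -/
theorem isIntegralClosure_normRing (hm : m ≠ 0) :
    IsIntegralClosure (NormRing m f) F[X] (FractionRing (CoordRing m f)) where
  algebraMap_injective := Subtype.val_injective
  isIntegral_iff {b} := by
    rw [← isIntegral_iff hm]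
    exact ⟨fun h => ⟨⟨b, h⟩, rfl⟩, fun ⟨c, hc⟩ => hc ▸ c.2⟩

end Domain

section Cover

variable {F : Type*} [Field F] {m : ℕ}

/-- The integral closure of `F[x]` in a cyclic extension of degree `m` of its fraction field is an
`m`-fold cyclic cover. -/
theorem isCyclicCover_of_isGalois (K L B : Type*) [Field K] [Field L] [CommRing B]
    [Algebra F[X] K] [IsFractionRing F[X] K] [Algebra K L] [Algebra F[X] L]
    [IsScalarTower F[X] K L] [Algebra F[X] B] [Algebra B L] [IsScalarTower F[X] B L]
    [IsIntegralClosure B F[X] L] [FiniteDimensional K L] [IsGalois K L] [IsCyclic Gal(L/K)]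
    (hcard : Module.finrank K L = m) : IsCyclicCover F m B := by
  have hB : IsDomain B := (IsIntegralClosure.algebraMap_injective B F[X] L).isDomain _
  have hD := IsIntegralClosure.isDedekindDomain F[X] K L B
  have := IsIntegralClosure.isFractionRing_of_finite_extension F[X] K L B
  have hinv := Algebra.isInvariant_of_isGalois' F[X] K L B
  refine ⟨hB, inferInstance, IsIntegralClosure.finite F[X] K L B, ?_, ?_, ?_, hinv.isInvariant⟩
  · have : Function.Injective (algebraMap F[X] L) := by
      rw [IsScalarTower.algebraMap_eq F[X] K L]
      exact (algebraMap K L).injective.comp (IsFractionRing.injective F[X] K)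
    rw [IsScalarTower.algebraMap_eq F[X] B L, RingHom.coe_comp] at this
    exact this.of_comp
  · exact isCyclic_of_surjective _ (galRestrict F[X] K L B).surjective
  · rw [← Nat.card_congr (galRestrict F[X] K L B).toEquiv, IsGalois.card_aut_eq_finrank, hcard]

theorem exists_isPrimitiveRoot [Fintype F] (hq : Fintype.card F ≡ 1 [MOD m]) :
    ∃ ζ : F, IsPrimitiveRoot ζ m := by
  obtain ⟨g, hg⟩ := IsCyclic.exists_ofOrder_eq_natCard (α := Fˣ)
  have hdvd : m ∣ orderOf g := by
    rw [hg, Nat.card_units, Nat.card_eq_fintype_card]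
    exact (Nat.modEq_iff_dvd' Fintype.card_pos).1 hq.symm
  obtain ⟨t, ht⟩ := hdvd
  have hpos : 0 < orderOf g := orderOf_pos g
  refine ⟨((g ^ t : Fˣ) : F), ?_⟩
  rw [IsPrimitiveRoot.coe_units_iff]
  exact (IsPrimitiveRoot.orderOf g).pow hpos (by rw [ht, mul_comm])

/-- In the presence of the `m`-th roots of unity, an irreducible curve `y ^ m = f(x)` normalizes to
a cyclic cover of the line: its function field is a Kummer extension. -/
theorem isCyclicCover_normRing {f : F[X]} (hm : m ≠ 0) {ζ : F} (hζ : IsPrimitiveRoot ζ m)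
    [IsDomain (CoordRing m f)] : IsCyclicCover F m (NormRing m f) := by
  have hirr := (isDomain_coordRing_iff (f := f) hm (FractionRing F[X])).1 inferInstance
  have hinjL := algebraMap_fractionRing_injective (f := f) hm
  have : FaithfulSMul F[X] (FractionRing (CoordRing m f)) :=
    (faithfulSMul_iff_algebraMap_injective _ _).2 hinjL
  let := FractionRing.liftAlgebra F[X] (FractionRing (CoordRing m f))
  have := FractionRing.isScalarTower_liftAlgebra F[X] (FractionRing (CoordRing m f))
  have := isIntegralClosure_normRing (f := f) hm
  have hy : rootY m f ^ m = algebraMap (FractionRing F[X]) (FractionRing (CoordRing m f))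
      (algebraMap F[X] _ f) := by
    rw [← IsScalarTower.algebraMap_apply, rootY_pow]
  have hyroot : aeval (rootY m f) (X ^ m - C (algebraMap F[X] (FractionRing F[X]) f)) = 0 := by
    simp [hy]
  have hmon : (X ^ m - C (algebraMap F[X] (FractionRing F[X]) f)).Monic :=
    monic_X_pow_sub_C _ hm
  have hyint : IsIntegral (FractionRing F[X]) (rootY m f) := ⟨_, hmon, hyroot⟩
  have htop : IntermediateField.adjoin (FractionRing F[X]) {rootY m f} = ⊤ := by
    rw [eq_top_iff]
    intro b _
    obtain ⟨h, p, hh, -, hb⟩ := exists_mul_eq_aeval hm b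
    have hh' := (map_ne_zero_iff _ hinjL).2 hh
    rw [mul_comm, ← eq_div_iff hh'] at hb
    rw [hb, IsScalarTower.algebraMap_apply F[X] (FractionRing F[X])]
    refine div_mem ?_ (IntermediateField.algebraMap_mem _ _)
    rw [← aeval_map_algebraMap (FractionRing F[X])]
    exact IntermediateField.algebra_adjoin_le_adjoin _ _ (aeval_mem_adjoin_singleton _ _)
  have hrank : Module.finrank (FractionRing F[X]) (FractionRing (CoordRing m f)) = m := by
    rw [← IntermediateField.finrank_top', ← htop, IntermediateField.adjoin.finrank hyint,
      ← minpoly.eq_of_irreducible_of_monic hirr hyroot hmon, natDegree_X_pow_sub_C]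
  have hfin : FiniteDimensional (FractionRing F[X]) (FractionRing (CoordRing m f)) :=
    FiniteDimensional.of_finrank_pos (by rw [hrank]; exact Nat.pos_of_ne_zero hm)
  have hprim : (primitiveRoots m (FractionRing F[X])).Nonempty :=
    ⟨_, (mem_primitiveRoots (Nat.pos_of_ne_zero hm)).2
      (hζ.map_of_injective (algebraMap F (FractionRing F[X])).injective)⟩
  have hsplit : IsSplittingField (FractionRing F[X]) (FractionRing (CoordRing m f))
      (X ^ m - C (algebraMap F[X] (FractionRing F[X]) f)) := by
    have := isSplittingField_X_pow_sub_C_of_root_adjoin_eq_top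
      (K := FractionRing F[X]) (L := FractionRing (CoordRing m f))
      (by rw [hrank]; exact hprim) (by rw [hrank]; exact hy) htop
    rwa [hrank] at this
  have : NeZero m := ⟨hm⟩
  have := isGalois_of_isSplittingField_X_pow_sub_C hprim hirr (FractionRing (CoordRing m f))
  have := isCyclic_of_isSplittingField_X_pow_sub_C hprim hirr (FractionRing (CoordRing m f))
  exact isCyclicCover_of_isGalois (FractionRing F[X]) (FractionRing (CoordRing m f)) _ hrank

end Cover

/-! ### Cyclic covers as superelliptic curves -/

section Kummer

variable {F : Type*} [Field F] {m : ℕ}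

/-- A cyclic extension of degree `m` of the rational function field is generated by an `m`-th root
of an `m`-th power-free polynomial: clear denominators and remove `m`-th powers from the radicand
supplied by Kummer theory. -/
theorem exists_powerFree_radicand (hm : 2 ≤ m) {K L : Type*} [Field K] [Field L] [Algebra F[X] K]
    [IsFractionRing F[X] K] [Algebra K L] [Algebra F[X] L] [IsScalarTower F[X] K L]
    [FiniteDimensional K L] [IsGalois K L] [IsCyclic Gal(L/K)] (hrank : Module.finrank K L = m)
    {ζ : K} (hζ : IsPrimitiveRoot ζ m) :
    ∃ (f : F[X]) (α : L), PowerFree m f ∧ α ^ m = algebraMap F[X] L f ∧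
      IntermediateField.adjoin K {α} = ⊤ := by
  have hinj : Function.Injective (algebraMap F[X] L) := by
    rw [IsScalarTower.algebraMap_eq F[X] K L]
    exact (algebraMap K L).injective.comp (IsFractionRing.injective F[X] K)
  obtain ⟨α, ⟨κ, hκ⟩, hα⟩ := exists_root_adjoin_eq_top_of_isCyclic K L
    (by rw [hrank]; exact ⟨ζ, (mem_primitiveRoots (by omega)).2 hζ⟩)
  rw [hrank] at hκ
  have hα0 : α ≠ 0 := by
    rintro rfl
    rw [IntermediateField.adjoin_zero] at hα
    have h1 := IntermediateField.finrank_bot (F := K) (E := L)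
    rw [hα, IntermediateField.finrank_top', hrank] at h1
    omega
  obtain ⟨n, d, hd, rfl⟩ := IsFractionRing.div_surjective F[X] κ
  have hd0 : d ≠ 0 := nonZeroDivisors.ne_zero hd
  have hdL := (map_ne_zero_iff _ hinj).2 hd0
  have hn : α ^ m * algebraMap F[X] L d = algebraMap F[X] L n := by
    rw [← hκ, map_div₀, ← IsScalarTower.algebraMap_apply, ← IsScalarTower.algebraMap_apply,
      div_mul_cancel₀ _ hdL]
  have hn0 : n ≠ 0 := by
    rintro rfl
    rw [map_zero] at hn
    exact mul_ne_zero (pow_ne_zero _ hα0) hdL hn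
  obtain ⟨g, h, hg, hh, hgh⟩ := exists_powerFree_part (m := m) (by omega)
    (mul_ne_zero hn0 (pow_ne_zero (m - 1) hd0))
  have hgL := (map_ne_zero_iff _ hinj).2 hg.ne_zero
  refine ⟨h, α * algebraMap F[X] L d / algebraMap F[X] L g, hh, ?_, ?_⟩
  · rw [div_pow, div_eq_iff (pow_ne_zero _ hgL), mul_pow, ← map_pow, ← map_pow, ← map_mul,
      mul_comm h, ← hgh, map_mul, ← hn, map_pow, map_pow, mul_assoc, ← pow_succ',
      Nat.sub_add_cancel (by omega)]
  · rw [eq_top_iff, ← hα, IntermediateField.adjoin_simple_le_iff]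
    set β := α * algebraMap F[X] L d / algebraMap F[X] L g with hβ
    have hmem : ∀ p : F[X], algebraMap F[X] L p ∈ IntermediateField.adjoin K {β} := fun p => by
      rw [IsScalarTower.algebraMap_apply F[X] K L]
      exact IntermediateField.algebraMap_mem _ _
    have h1 : α = β * algebraMap F[X] L g / algebraMap F[X] L d := by
      rw [hβ]
      field_simp
    have h2 : β * algebraMap F[X] L g / algebraMap F[X] L d ∈ IntermediateField.adjoin K {β} :=
      div_mem (mul_mem (IntermediateField.mem_adjoin_simple_self _ _) (hmem g)) (hmem d)
    rwa [← h1] at h2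

end Kummer

section Converse

variable {F : Type*} [Field F] {m : ℕ}

/-- If `α` generates an extension of degree `m` of the rational function field and `α ^ m = f`, then
the curve `C_f` is integral and this extension is its function field. -/
theorem exists_algEquiv_fractionRing (hm : m ≠ 0) {f : F[X]} {L : Type*} [Field L]
    [Algebra (FractionRing F[X]) L] [Algebra F[X] L] [IsScalarTower F[X] (FractionRing F[X]) L]
    [FiniteDimensional (FractionRing F[X]) L]
    (hrank : Module.finrank (FractionRing F[X]) L = m) {α : L} (hα : α ^ m = algebraMap F[X] L f)
    (htop : IntermediateField.adjoin (FractionRing F[X]) {α} = ⊤) :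
    IsDomain (CoordRing m f) ∧ Nonempty (FractionRing (CoordRing m f) ≃ₐ[F[X]] L) := by
  set K := FractionRing F[X] with hK
  have hinj := IsFractionRing.injective F[X] K
  have hαK : α ^ m = algebraMap K L (algebraMap F[X] K f) := by
    rw [← IsScalarTower.algebraMap_apply, hα]
  have hirr : Irreducible (X ^ m - C (algebraMap F[X] K f)) := by
    have := irreducible_X_pow_sub_C_of_root_adjoin_eq_top (K := K) (L := L)
      (by rw [hrank]; exact hαK) htop
    rwa [hrank] at this
  have hdom := (isDomain_coordRing_iff (f := f) hm K).2 hirr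
  refine ⟨hdom, ?_⟩
  have hmap : (X ^ m - C f : F[X][X]).map (algebraMap F[X] K) =
      X ^ m - C (algebraMap F[X] K f) := by simp
  have hminpoly := minpoly.eq_of_irreducible_of_monic (x := α) hirr (by simp [hαK])
    (monic_X_pow_sub_C _ hm)
  let φ₀ : CoordRing m f →ₐ[F[X]] L := AdjoinRoot.liftAlgHom _ (Algebra.ofId F[X] L) α (by
    rw [eval₂_sub, eval₂_pow, eval₂_X, eval₂_C, hα]
    exact sub_self _)
  have hφ₀ : ∀ p : F[X][X], φ₀ (AdjoinRoot.mk _ p) = aeval α p := fun p => by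
    simp only [φ₀, AdjoinRoot.liftAlgHom_mk]
    rfl
  have hφ₀inj : Function.Injective φ₀ := by
    rw [injective_iff_map_eq_zero]
    intro a ha
    obtain ⟨p, rfl⟩ := AdjoinRoot.mk_surjective a
    rw [hφ₀, ← aeval_map_algebraMap K] at ha
    rw [AdjoinRoot.mk_eq_zero, ← map_dvd_map _ hinj (monic_defining hm f), hmap, hminpoly]
    exact minpoly.dvd K α ha
  have hinjL := algebraMap_fractionRing_injective (f := f) hm
  have : FaithfulSMul F[X] (FractionRing (CoordRing m f)) :=
    (faithfulSMul_iff_algebraMap_injective _ _).2 hinjL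
  let := FractionRing.liftAlgebra F[X] (FractionRing (CoordRing m f))
  have := FractionRing.isScalarTower_liftAlgebra F[X] (FractionRing (CoordRing m f))
  let φ : FractionRing (CoordRing m f) →ₐ[F[X]] L :=
    IsFractionRing.liftAlgHom (K := FractionRing (CoordRing m f)) hφ₀inj
  have hφα : φ (rootY m f) = α := by
    rw [rootY]
    simp [φ, φ₀]
  let φK : FractionRing (CoordRing m f) →ₐ[K] L := { φ with
    commutes' := fun x => by
      obtain ⟨n, d, -, rfl⟩ := IsFractionRing.div_surjective F[X] x
      change φ _ = _
      simp only [map_div₀, ← IsScalarTower.algebraMap_apply, AlgHom.commutes] }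
  have hsurj : Function.Surjective φ := by
    intro b
    have : (⊤ : IntermediateField K L) ≤ φK.fieldRange := by
      rw [← htop, IntermediateField.adjoin_simple_le_iff]
      exact ⟨rootY m f, hφα⟩
    exact this (IntermediateField.mem_top (x := b))
  exact ⟨AlgEquiv.ofBijective φ ⟨φ.toRingHom.injective, hsurj⟩⟩

/-- In the presence of the `m`-th roots of unity, every `m`-fold cyclic cover of the line is the
normalization of a curve `y ^ m = f(x)` with `f` free of `m`-th powers. -/
theorem IsCyclicCover.exists_powerFree (hm : 2 ≤ m) {ζ : F} (hζ : IsPrimitiveRoot ζ m)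
    {B : Type*} [CommRing B] [Algebra F[X] B] (hB : IsCyclicCover F m B) :
    ∃ f : F[X], PowerFree m f ∧ NormIrreducible m f ∧ Nonempty (B ≃ₐ[F[X]] NormRing m f) := by
  have hm0 : m ≠ 0 := by omega
  have := hB.isDomain
  have := hB.isIntegrallyClosed
  have := hB.finite
  have := hB.isCyclic
  have hfaith : FaithfulSMul F[X] B := (faithfulSMul_iff_algebraMap_injective _ _).2 hB.injective
  have hfaith' : FaithfulSMul F[X] (FractionRing B) := by
    rw [faithfulSMul_iff_algebraMap_injective, IsScalarTower.algebraMap_eq F[X] B]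
    exact (IsFractionRing.injective B _).comp hB.injective
  let := FractionRing.liftAlgebra F[X] (FractionRing B)
  have := FractionRing.isScalarTower_liftAlgebra F[X] (FractionRing B)
  have hG : IsGaloisGroup (B ≃ₐ[F[X]] B) F[X] B :=
    ⟨inferInstance, inferInstance, ⟨hB.invariant⟩⟩
  have hGfin : Finite (B ≃ₐ[F[X]] B) :=
    Nat.finite_of_card_ne_zero (by rw [hB.card_aut]; exact hm0)
  let := IsFractionRing.mulSemiringAction (B ≃ₐ[F[X]] B) B (FractionRing B)
  have hGK : IsGaloisGroup (B ≃ₐ[F[X]] B) (FractionRing F[X]) (FractionRing B) :=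
    IsGaloisGroup.toFractionRing (B ≃ₐ[F[X]] B) F[X] B
  have := IsGaloisGroup.finiteDimensional (B ≃ₐ[F[X]] B) (FractionRing F[X]) (FractionRing B)
  have := IsGaloisGroup.isGalois (B ≃ₐ[F[X]] B) (FractionRing F[X]) (FractionRing B)
  have hrank : Module.finrank (FractionRing F[X]) (FractionRing B) = m := by
    rw [← IsGaloisGroup.card_eq_finrank (B ≃ₐ[F[X]] B), hB.card_aut]
  have : IsCyclic Gal(FractionRing B/FractionRing F[X]) := isCyclic_of_surjective _
    (IsGaloisGroup.mulEquivAlgEquiv (B ≃ₐ[F[X]] B) (FractionRing F[X]) (FractionRing B)).surjective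
  obtain ⟨f, α, hf, hα, htop⟩ := exists_powerFree_radicand (F := F) hm (L := FractionRing B) hrank
    (hζ.map_of_injective (algebraMap F (FractionRing F[X])).injective)
  obtain ⟨hdom, ⟨φ⟩⟩ := exists_algEquiv_fractionRing hm0 hrank hα htop
  refine ⟨f, hf, ?_, ⟨?_⟩⟩
  · unfold NormIrreducible
    infer_instance
  · have := isIntegralClosure_normRing (f := f) hm0
    have : IsIntegralClosure B F[X] (FractionRing B) := .of_isIntegrallyClosed _ _ _
    exact ((IsIntegralClosure.equiv F[X] B (FractionRing B) (integralClosure F[X] _)).trans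
      φ.symm.mapIntegralClosure).trans
      (IsIntegralClosure.equiv F[X] (integralClosure F[X] _) (FractionRing (CoordRing m f)) _)

end Converse

end Superelliptic

/-! ### Point counts and cyclic covers -/

theorem theorem2 (F : Type*) [Field F] [Fintype F] (m : ℕ) (hm : 2 ≤ m)
    (hqm : Nat.Coprime (Fintype.card F) m) :
    (∀ (Ω : Type*) [MeasurableSpace Ω] (μ : Measure Ω) [IsProbabilityMeasure μ]
      (Y : Fin (Fintype.card F) → Ω → ℕ),
      iIndepFun Y μ →
      (∀ j, HasLaw (Y j)
        (Superelliptic.pointLaw (Fintype.card F) m Fintype.one_lt_card (by omega)).toMeasure μ) →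
      ∀ k : ℕ,
        Tendsto (fun d : ℕ => Superelliptic.proportion m (fun _ : F[X] => True) k d) atTop
          (𝓝 (μ.real {ω | ∑ j, Y j ω = k})) ∧
        Tendsto (fun d : ℕ =>
            Superelliptic.proportion m (fun f : F[X] => Superelliptic.NormIrreducible m f) k d)
          atTop (𝓝 (μ.real {ω | ∑ j, Y j ω = k})) ∧
        Tendsto (fun d : ℕ =>
            Superelliptic.proportion m (fun f : F[X] => Superelliptic.NormGeomIrreducible m f) k d)
          atTop (𝓝 (μ.real {ω | ∑ j, Y j ω = k}))) ∧
    (Fintype.card F ≡ 1 [MOD m] →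
      (∀ f : F[X], Superelliptic.PowerFree m f → Superelliptic.NormIrreducible m f →
        Superelliptic.IsCyclicCover F m (Superelliptic.NormRing m f)) ∧
      (∀ (B : Type*) [CommRing B] [Algebra F[X] B], Superelliptic.IsCyclicCover F m B →
        ∃ f : F[X], Superelliptic.PowerFree m f ∧ Superelliptic.NormIrreducible m f ∧
          Nonempty (B ≃ₐ[F[X]] Superelliptic.NormRing m f))) := by
  have hm0 : m ≠ 0 := by omega
  have hmF : (m : F) ≠ 0 := by
    obtain ⟨p, hp⟩ := CharP.exists F
    have hpp : p.Prime := (CharP.char_is_prime F p)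
    rw [Ne, CharP.cast_eq_zero_iff F p]
    intro hpm
    have hpq : p ∣ Fintype.card F := by
      rw [← CharP.cast_eq_zero_iff F p, FiniteField.cast_card_eq_zero]
    exact hpp.one_lt.ne' (Nat.dvd_one.1 (hqm ▸ Nat.dvd_gcd hpq hpm))
  have hgeom : ∀ f : F[X], f ≠ 0 → ¬Superelliptic.IsDegenerate m f →
      IsDomain (Superelliptic.CoordRing m f) ∧ Superelliptic.NormIrreducible m f ∧
        Superelliptic.NormGeomIrreducible m f := fun f hf hdeg =>
    Superelliptic.geomIrreducible_of_forall_prime hm0 hf fun p hp hpm c g h =>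
      hdeg ⟨p, hp, hpm, c, g, h⟩
  have hN : ∀ (f : F[X]) (τ : F → Fin m × Fˣ), ¬Superelliptic.IsDegenerate m f →
      Superelliptic.HasType f τ →
      Superelliptic.numPoints m f = ∑ a, Superelliptic.localPoints (τ a) := by
    intro f τ hdeg hτ
    have hf : f ≠ 0 := by
      rintro rfl
      -- the zero polynomial is the `p`-th power of itself
      obtain ⟨p, hp, hpm⟩ := Nat.exists_prime_and_dvd (n := m) (by omega)
      exact hdeg ⟨p, hp, hpm, 0, 0, by simp⟩
    have := (hgeom f hf hdeg).1
    exact Superelliptic.numPoints_eq hm0 hmF hτ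
  refine ⟨fun Ω _ μ _ Y hind hY k => ?_, fun hq => ?_⟩
  · rw [Superelliptic.measureReal_sum_eq (by omega) hind hY k]
    refine ⟨?_, ?_, ?_⟩
    · exact Superelliptic.tendsto_proportion hm hqm (fun _ _ _ => trivial) hN k
    · exact Superelliptic.tendsto_proportion hm hqm
        (fun f hf hdeg => (hgeom f hf.ne_zero hdeg).2.1) hN k
    · exact Superelliptic.tendsto_proportion hm hqm
        (fun f hf hdeg => (hgeom f hf.ne_zero hdeg).2.2) hN k
  · obtain ⟨ζ, hζ⟩ := Superelliptic.exists_isPrimitiveRoot hq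
    refine ⟨fun f hf hirr => ?_, fun B _ _ hB => hB.exists_powerFree hm hζ⟩
    have := Superelliptic.isDomain_coordRing hm0 hmF hf.ne_zero hirr
    exact Superelliptic.isCyclicCover_normRing hm0 hζ
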